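/- Let $d,N\ge 1$, $s\in\mathbb R$, $p,q\in(0,+\infty]$ (with $d/p=0$ if $p=\infty$). Let $\psi^{(1)},\dots,\psi^{(N)}$ be real- or complex-valued functions on $\mathbb R^d$ that are bounded with fast decay (for every $n$ there is $C_n$ with $|\psi^{(i)}(x)|\le C_n(1+|x|)^{-n}$), and let $\psi^{(i)}_{j,k}(x)=\psi^{(i)}(2^jx-k)$ for $j\ge0$, $k\in\mathbb Z^d$. We index coefficients and wavelets by $(i,j,k)$ or by $(i,\lambda)$, where $\lambda=\lambda_{j,k}=2^{-j}(k+[0,1)^d)$ is a dyadic cube of scale $j$. **Spaces and divergence.** A sequence $\mathcal A=\{a^{(i)}_{j,k}\}$ belongs to $b^{s,q}_p$ if the numbers $\varepsilon_j=\big(\sum_{i,k}|a^{(i)}_{j,k}2^{(s-d/p)j}|^p\big)^{1/p}$ (a supremum if $p=\infty$) satisfy $(\varepsilon_j)_{j\ge0}\in\ell^q$. The wavelet series $\sum a^{(i)}_{j,k}\psi^{(i)}_{j,k}$ diverges at rate at least $\gamma\in\mathbb R$ at $x$ if there are $C>0$ and indices $(i_n,j_n,k_n)$ with $j_n\to+\infty$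 and $|a^{(i_n)}_{j_n,k_n}\psi^{(i_n)}_{j_n,k_n}(x)|\ge C2^{\gamma j_n}$ for all $n$; the divergence exponent $\delta_{\mathcal A}(x)\in[-\infty,+\infty]$ is the supremum of all such $\gamma$. The series is maximally divergent in a set $A\subset\mathbb R^d$ if $\mathcal A\in b^{s,q}_p$ and 1. $\delta_{\mathcal A}(x)\in[-s,\frac dp-s]$ for every $x\in A$; 2. $\delta_{\mathcal A}(x)=-s$ for Lebesgue-almost every $x\in A$; 3. for every non-empty open set $B\subset\mathbb R^d$ with $B\subset A$ and every $\gamma\in[-s,\frac dp-s]$, the Hausdorff dimension of $\{x\in B:\delta_{\mathcal A}(x)=\gamma\}$ is $d-sp-\gamma p$ (read as $d$ if $p=\infty$, $\gamma=-s$). **Dyadic covering.** Assume that the wavelet system has the dyadic covering property, and fix triplets $(i_l,j_l,k_l)$, $1\le l\le L$, with $j_l>0$ and a constant $C_0>0$ such that for every $x\in[0,1)^d$ there is $l$ with $|\psi^{(i_l)}(2^{j_l}x-k_l)|\ge C_0$. Let $M=\max_l j_l$. For a cube $\nu=\lambda_{j,k}$ put $\mu^l(\nu)=\lambda_{j+j_l,\,2^{j_l}k+k_l}$.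 **The saturating sequence.** For $j\ge1$, $k\in\{0,\dots,2^j-1\}^d$ and $\lambda=\lambda_{j,k}$, let $J\le j$ be the least non-negative integer such that $2^{J}\,k/2^{j}\in\mathbb Z^d$, and put $e_\lambda=2^{-(\log j)^2}\,2^{(\frac dp-s)j}\,2^{-\frac dpJ}$. For a dyadic cube $\lambda$ of scale $j\in\{mM+1,\dots,(m+1)M\}$ with $m\ge1$, let $f_\lambda$ be the supremum of $e_\nu$ over the dyadic cubes $\nu\subseteq[0,1)^d$ of scale $mM$ such that $\mu^l(\nu)=\lambda$ for some $l$, and $f_\lambda=0$ if there is no such $\nu$; put $f_\lambda=0$ if $j\le M$. Let $\xi^{(i)}_\lambda$ be independent random variables, uniformly distributed on $[-1,1]$, and let $\mathcal C=\{\xi^{(i)}_\lambda f_\lambda\}$. **Corollary.** For every fixed (deterministic, real or complex) sequence $\mathcal D\in b^{s,q}_p$, almost surely the wavelet series associated with $\mathcal C+\mathcal D$ is maximally divergent in $[0,1)^d$. -/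

import Mathlib

open MeasureTheory ProbabilityTheory Set Filter
open scoped ENNReal Topology

noncomputable section

namespace WaveletDivergence

/-- A family of coefficients `c i j k`, for `1 ≤ i ≤ N`, scales `j ≥ 0` and `k ∈ ℤ^d`.
The index pair `(j, k)` also stands for the dyadic cube `2^{-j} (k + [0,1)^d)`. -/
abbrev Coeffs (𝕜 : Type*) (d N : ℕ) : Type _ := Fin N → ℕ → (Fin d → ℤ) → 𝕜

variable {𝕜 : Type*} [RCLike 𝕜] {d N : ℕ}

/-- The half-open unit cube `[0,1)^d`. -/
def unitCube (d : ℕ) : Set (Fin d → ℝ) := {x | ∀ a, 0 ≤ x a ∧ x a < 1}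

/-- The number `d / p`, equal to `0` when `p = ∞`. -/
def dimOver (d : ℕ) (p : ℝ≥0∞) : ℝ := ((d : ℝ≥0∞) / p).toReal

/-- The generating functions are bounded and have fast decay.
(Any norm on `ℝ^d` gives the same condition.) -/
def IsWaveletSystem (ψ : Fin N → (Fin d → ℝ) → 𝕜) : Prop :=
  ∀ i, (∃ C : ℝ, ∀ x, ‖ψ i x‖ ≤ C) ∧
    ∀ n : ℕ, ∃ C : ℝ, ∀ x, ‖ψ i x‖ ≤ C / (1 + ‖x‖) ^ n

/-- The wavelet `ψ_{j,k}^{(i)}(x) = ψ^{(i)}(2^j x - k)`. -/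
def wavelet (ψ : Fin N → (Fin d → ℝ) → 𝕜) (i : Fin N) (j : ℕ) (k : Fin d → ℤ)
    (x : Fin d → ℝ) : 𝕜 :=
  ψ i (fun a => (2 : ℝ) ^ j * x a - (k a : ℝ))

/-- The wavelet series with coefficients `c` diverges at rate at least `γ` at `x`. -/
def DivergesAtRate (ψ : Fin N → (Fin d → ℝ) → 𝕜) (c : Coeffs 𝕜 d N) (γ : ℝ)
    (x : Fin d → ℝ) : Prop :=
  ∃ C : ℝ, 0 < C ∧ ∃ (i : ℕ → Fin N) (j : ℕ → ℕ) (k : ℕ → Fin d → ℤ),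
    Tendsto j atTop atTop ∧
      ∀ n, C * (2 : ℝ) ^ (γ * (j n : ℝ)) ≤
        ‖c (i n) (j n) (k n) * wavelet ψ (i n) (j n) (k n) x‖

/-- The divergence exponent at `x`: the supremum, in the extended reals, of the rates at which
the series diverges at `x` (it is `-∞` if there are none). -/
def divExponent (ψ : Fin N → (Fin d → ℝ) → 𝕜) (c : Coeffs 𝕜 d N) (x : Fin d → ℝ) : EReal :=
  sSup {e : EReal | ∃ γ : ℝ, DivergesAtRate ψ c γ x ∧ e = (γ : EReal)}

/-- The normalized moduli `|c^{(i)}_{j,k}| 2^{(s - d/p) j}` of the coefficients of scale `j`. -/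
def besovLevel (s : ℝ) (p : ℝ≥0∞) (c : Coeffs 𝕜 d N) (j : ℕ) : Fin N × (Fin d → ℤ) → ℝ :=
  fun ik => ‖c ik.1 j ik.2‖ * (2 : ℝ) ^ ((s - dimOver d p) * (j : ℝ))

/-- The discrete Besov space `b^{s,q}_p`: at each scale `j` the normalized coefficients are
in `ℓ^p`, and their `ℓ^p` (quasi-)norms form a sequence in `ℓ^q`. -/
def InBesov (s : ℝ) (p q : ℝ≥0∞) (c : Coeffs 𝕜 d N) : Prop :=
  ∃ h : ∀ j, Memℓp (besovLevel s p c j) p,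
    Memℓp (fun j : ℕ =>
      ‖(⟨besovLevel s p c j, h j⟩ : lp (fun _ : Fin N × (Fin d → ℤ) => ℝ) p)‖) q

/-- Maximal divergence in `A` of the wavelet series of a sequence of `b^{s,q}_p`.
The dimension `d - s p - γ p` is written `d - p (s + γ)`: for `γ ∈ [-s, d/p - s]` one has
`0 ≤ s + γ` and `p (s + γ) ≤ d`, so nothing is truncated, and for `p = ∞`, where `γ = -s` is
the only possible value, it is `d - ∞ * 0 = d`.
Hausdorff dimension and null sets do not depend on the choice of a norm on `ℝ^d`. -/
def IsMaximallyDivergent (ψ : Fin N → (Fin d → ℝ) → 𝕜) (s : ℝ) (p q : ℝ≥0∞)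
    (A : Set (Fin d → ℝ)) (c : Coeffs 𝕜 d N) : Prop :=
  InBesov s p q c ∧
  (∀ x ∈ A, divExponent ψ c x ∈
    Set.Icc ((-s : ℝ) : EReal) ((dimOver d p - s : ℝ) : EReal)) ∧
  (∀ᵐ x ∂(volume : Measure (Fin d → ℝ)), x ∈ A →
    divExponent ψ c x = ((-s : ℝ) : EReal)) ∧
  (∀ B : Set (Fin d → ℝ), IsOpen B → B.Nonempty → B ⊆ A →
    ∀ γ : ℝ, γ ∈ Set.Icc (-s) (dimOver d p - s) →
      dimH {x | x ∈ B ∧ divExponent ψ c x = (γ : EReal)} =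
        (d : ℝ≥0∞) - p * ENNReal.ofReal (s + γ))

/-- A finite collection of triplets `(i_l, j_l, k_l)` that witnesses the dyadic covering
property of the wavelet system generated by `ψ`. -/
structure DyadicCovering (ψ : Fin N → (Fin d → ℝ) → 𝕜) where
  /-- the number of triplets -/
  L : ℕ
  /-- the indices `i_l` of the wavelets -/
  idx : Fin L → Fin N
  /-- the scales `j_l` -/
  scale : Fin L → ℕ
  /-- the positions `k_l` -/
  pos : Fin L → Fin d → ℤ
  scale_pos : ∀ l, 0 < scale l
  exists_bound : ∃ C₀ : ℝ, 0 < C₀ ∧ ∀ x ∈ unitCube d, ∃ l,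
    C₀ ≤ ‖wavelet ψ (idx l) (scale l) (pos l) x‖

namespace DyadicCovering

variable {ψ : Fin N → (Fin d → ℝ) → 𝕜}

/-- The depth `M`: the largest of the scales `j_l`. -/
def depth (T : DyadicCovering ψ) : ℕ := Finset.univ.sup T.scale

/-- The `l`-th cube `μ^l(ν)` of the dyadic covering of the cube `ν = (j, k)`. It lies with
respect to `ν` as the cube `(j_l, k_l)` lies with respect to `[0,1)^d`, so that
`ψ^{(i)}_{μ^l(ν)}(x) = ψ^{(i)}(2^{j_l} (2^j x - k) - k_l)`. -/
def cube (T : DyadicCovering ψ) (l : Fin T.L) (j : ℕ) (k : Fin d → ℤ) : ℕ × (Fin d → ℤ) :=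
  (j + T.scale l, fun a => 2 ^ T.scale l * k a + T.pos l a)

end DyadicCovering

/-- The exponent `J ≤ j` of the irreducible form `k / 2^j = k' / 2^J`: the least `J` such
that `2^J (k / 2^j)` has integer coordinates (so `J = 0` if `k = 0`). -/
def irredScale (j : ℕ) (k : Fin d → ℤ) : ℕ :=
  sInf {J : ℕ | ∃ k' : Fin d → ℤ, ∀ a, k a * 2 ^ J = k' a * 2 ^ j}

/-- `e_λ = 2^{-(log j)^2} 2^{(d/p - s) j} 2^{-(d/p) J}` for the cube `λ = (j, k)`. -/
def eCoeff (s : ℝ) (p : ℝ≥0∞) (j : ℕ) (k : Fin d → ℤ) : ℝ :=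
  (2 : ℝ) ^ (-(Real.log (j : ℝ)) ^ 2) * (2 : ℝ) ^ ((dimOver d p - s) * (j : ℝ)) *
    (2 : ℝ) ^ (-(dimOver d p * (irredScale j k : ℝ)))

/-- `f_λ` for the cube `λ = (j, k)` with `m M + 1 ≤ j ≤ (m + 1) M`, `m ≥ 1`: the supremum of
`e_ν` over the cubes `ν ⊆ [0,1)^d` of scale `m M` whose dyadic covering contains `λ`.
This is a finite set; if it is empty, and if `j ≤ M`, then `f_λ = sSup ∅ = 0`. -/
def fCoeff {ψ : Fin N → (Fin d → ℝ) → 𝕜} (T : DyadicCovering ψ) (s : ℝ) (p : ℝ≥0∞)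
    (j : ℕ) (k : Fin d → ℤ) : ℝ :=
  sSup {y : ℝ | ∃ m : ℕ, 1 ≤ m ∧ m * T.depth + 1 ≤ j ∧ j ≤ (m + 1) * T.depth ∧
    ∃ ν : Fin d → ℤ, (∀ a, 0 ≤ ν a ∧ ν a < 2 ^ (m * T.depth)) ∧
      (∃ l, T.cube l (m * T.depth) ν = (j, k)) ∧ y = eCoeff s p (m * T.depth) ν}

/-- The saturating sequence `c^{(i)}_λ = ξ^{(i)}_λ f_λ` driven by the numbers `ξ^{(i)}_λ`. -/
def saturating {ψ : Fin N → (Fin d → ℝ) → 𝕜} (T : DyadicCovering ψ) (s : ℝ) (p : ℝ≥0∞)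
    (ξ : Fin N × ℕ × (Fin d → ℤ) → ℝ) : Coeffs 𝕜 d N :=
  fun i j k => ((ξ (i, j, k) * fCoeff T s p j k : ℝ) : 𝕜)

end WaveletDivergence

end

noncomputable section

namespace WaveletDivergence

/-! Upper bounds hold for every sequence of `b^{s,q}_p`. Its coefficients are `O(2^{(d/p-s)j})` and
the wavelets are bounded, so the exponent is at most `d/p - s`. By fast decay, a point of exponent
greater than `γ` lies within `2^{(ε-1)j}` of the corner `2^{-j} k` of a coefficient of size about
`2^{γj}`, for infinitely many `j`. There are at most about `2^{(d-sp-γp)j}` such coefficients at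
scale `j`, and covering gives dimension at most `d - sp - γp` (`dimH_le_divExponent_le`).

For the lower bounds, randomness is used once. A uniform variable shifted by a deterministic number
is small with small probability. A union bound over dyadic cubes and Borel-Cantelli show that almost
surely, for all large `n` and all `x`, some block `m` in `[n, n + √n]` has all the coefficients of
the covering of the cube around `x` at least `e_ν`, up to a subexponential factor
(`ae_eventually_exists_large`, `IsLargeNear`). The rest is deterministic. Since `J ≤ j`, the
exponent is at least `-s` everywhere. It is at least `d/p - s - (d/p)θ` at points whose cubes
satisfy `J ≤ θ j` throughout infinitely many such windows (`IsLargeNear.le_divExponent`).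

Enough such points come from spreading binary digits: the digits of `u` are moved to positions `φ
n`, with occasional gaps running from `J` to about `J/θ`, which place the image very near a dyadic
corner of scale `J`. The gaps are rare enough, yet infinitely many, that `φ n ≤ A n + C` for every
`A > 1/θ`. The inverse of the spreading map is then Hölder of every exponent below `θ`, and sets of
dimension less than `θ d` have null preimages (`volume_inter_preimage_eq_zero`). The sets of
exponent at least `d/p - s - (d/p)θ + η`, `η > 0`, have such null preimages by the upper bound. Were
the level set also of dimension less than `θ d`, the unit cube would be null
(`IsLargeNear.le_dimH_level`). -/

/-! ### Spreading the binary digits of a number -/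

/-- Positions of digits, with a gap from `w (gapSeq w n)` whenever the excess
`gapSeq w n - n` is at most `√n`. -/
def gapSeq (w : ℕ → ℕ) : ℕ → ℕ
  | 0 => 0
  | n + 1 => if (gapSeq w n - n) ^ 2 ≤ n then w (gapSeq w n) + 1 else gapSeq w n + 1

section GapSeq

variable {w : ℕ → ℕ}

theorem gapSeq_strictMono (hw : ∀ J, J ≤ w J) : StrictMono (gapSeq w) := by
  refine strictMono_nat_of_lt_succ fun n => ?_
  rw [gapSeq]
  have := hw (gapSeq w n)
  split_ifs <;> omega

/-- Without gaps the excess `gapSeq w n - n` stays constant, so its square is eventually at most `n`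
and a gap must occur. -/
theorem exists_gap (w : ℕ → ℕ) (N : ℕ) :
    ∃ n, N ≤ n ∧ gapSeq w (n + 1) = w (gapSeq w n) + 1 := by
  by_contra! h
  have step : ∀ n, N ≤ n → ¬ (gapSeq w n - n) ^ 2 ≤ n := by
    intro n hn h'
    apply h n hn
    rw [gapSeq, if_pos h']
  have const : ∀ k, gapSeq w (N + k) = gapSeq w N + k := by
    intro k
    induction k with
    | zero => rfl
    | succ k ih => rw [← add_assoc, gapSeq, if_neg (step _ (by omega)), ih]; rfl
  have h1 := step (N + (gapSeq w N) ^ 2) (by omega)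
  apply h1
  rw [const]
  have : gapSeq w N + gapSeq w N ^ 2 - (N + gapSeq w N ^ 2) ≤ gapSeq w N := by omega
  calc _ ≤ (gapSeq w N) ^ 2 := Nat.pow_le_pow_left this 2
    _ ≤ _ := by omega

/-- A gap starts only at a position at most `n + √n`, so it ends near `α n` up to `O(√n)`, which is
absorbed by the slack between `α` and `A`. Elsewhere the increment is `1 ≤ A`. -/
theorem gapSeq_le (hw : ∀ J, J ≤ w J) {α : ℝ} (hα : 1 ≤ α)
    (hgrow : ∀ A, α < A → ∃ C, ∀ J : ℕ, (w J : ℝ) ≤ A * J + C) {A : ℝ} (hA : α < A) :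
    ∃ C, 0 ≤ C ∧ ∀ n : ℕ, (gapSeq w n : ℝ) ≤ A * n + C := by
  obtain ⟨C, hC⟩ := hgrow ((α + A) / 2) (by linarith)
  set A' := (α + A) / 2 with hA'
  have hAA : 0 < A - A' := by rw [hA']; linarith
  -- The three terms pay for the constant of `hgrow`, the `+ 1` of a gap, and the remainder in the
  -- bound of `A' * e` by `(A - A') * e ^ 2`.
  set D := |C| + 1 + A' ^ 2 / (A - A') with hD
  have hq : 0 ≤ A' ^ 2 / (A - A') := by positivity
  refine ⟨D, by positivity, fun n => ?_⟩
  induction n with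
  | zero => simp only [gapSeq, Nat.cast_zero, mul_zero, zero_add]; positivity
  | succ n ih =>
    have hle : n ≤ gapSeq w n := (gapSeq_strictMono hw).le_apply
    rw [gapSeq]
    split_ifs with h
    · have h1 := hC (gapSeq w n)
      have h2 : ((gapSeq w n : ℝ) - n) ^ 2 ≤ n := by
        have : (((gapSeq w n - n : ℕ) : ℝ)) ^ 2 ≤ n := by exact_mod_cast h
        rwa [Nat.cast_sub hle] at this
      set e : ℝ := (gapSeq w n : ℝ) - n with he
      have h3 : A' * e ≤ (A - A') * n + A' ^ 2 / (A - A') := by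
        have h4 : (A - A') * e ^ 2 ≤ (A - A') * n := mul_le_mul_of_nonneg_left h2 hAA.le
        have h5 : A' * e ≤ (A - A') * e ^ 2 + A' ^ 2 / (A - A') := by
          have : A' ^ 2 / (A - A') = (A - A') * (A' / (A - A')) ^ 2 := by field_simp
          rw [this]
          have h6 : A' * e = (A - A') * ((A' / (A - A')) * e) := by field_simp
          rw [h6, ← mul_add]
          apply mul_le_mul_of_nonneg_left _ hAA.le
          nlinarith [sq_nonneg (A' / (A - A') - e), sq_nonneg (A' / (A - A')), sq_nonneg e]
        linarith
      push_cast
      have : (gapSeq w n : ℝ) = n + e := by rw [he]; ring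
      rw [this] at h1
      have := le_abs_self C
      nlinarith
    · push_cast
      nlinarith

end GapSeq

/-- The binary digit of `u` of order `m + 1`. -/
def binDigit (u : ℝ) (m : ℕ) : ℤ := ⌊(2 : ℝ) ^ (m + 1) * u⌋ - 2 * ⌊(2 : ℝ) ^ m * u⌋

theorem binDigit_nonneg (u : ℝ) (m : ℕ) : 0 ≤ binDigit u m := by
  have : 2 * ⌊(2 : ℝ) ^ m * u⌋ ≤ ⌊(2 : ℝ) ^ (m + 1) * u⌋ := by
    rw [Int.le_floor]
    push_cast
    have := Int.floor_le ((2 : ℝ) ^ m * u)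
    rw [pow_succ]; linarith
  unfold binDigit; omega

theorem binDigit_le_one (u : ℝ) (m : ℕ) : binDigit u m ≤ 1 := by
  have : ⌊(2 : ℝ) ^ (m + 1) * u⌋ < 2 * ⌊(2 : ℝ) ^ m * u⌋ + 2 := by
    rw [Int.floor_lt]
    push_cast
    have := Int.lt_floor_add_one ((2 : ℝ) ^ m * u)
    rw [pow_succ]; linarith
  unfold binDigit; omega

/-- The number whose binary digit of order `φ (m + 1)` is the digit of `u` of order `m + 1`. -/
def spread (φ : ℕ → ℕ) (u : ℝ) : ℝ := ∑' m, (binDigit u m : ℝ) * (1 / 2) ^ φ (m + 1)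

/-- The contribution to `spread` of the first `n` digits. -/
def spreadSum (φ : ℕ → ℕ) (u : ℝ) (n : ℕ) : ℝ :=
  ∑ m ∈ Finset.range n, (binDigit u m : ℝ) * (1 / 2) ^ φ (m + 1)

section Spread

variable {φ : ℕ → ℕ}

theorem spread_term_nonneg (u : ℝ) (m : ℕ) : 0 ≤ (binDigit u m : ℝ) * (1 / 2) ^ φ (m + 1) :=
  mul_nonneg (by exact_mod_cast binDigit_nonneg u m) (by positivity)

theorem spread_term_le (hφ : StrictMono φ) (u : ℝ) (n m : ℕ) :
    (binDigit u (m + n) : ℝ) * (1 / 2) ^ φ (m + n + 1) ≤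
      (1 / 2) ^ φ (n + 1) * (1 / 2 : ℝ) ^ m := by
  have h1 : (binDigit u (m + n) : ℝ) ≤ 1 := by exact_mod_cast binDigit_le_one u (m + n)
  have h2 : φ (n + 1) + m ≤ φ (m + n + 1) := by
    have := hφ.add_le_nat m (n + 1)
    rw [add_assoc]; omega
  calc _ ≤ 1 * (1 / 2 : ℝ) ^ φ (m + n + 1) := by gcongr
    _ ≤ (1 / 2) ^ (φ (n + 1) + m) := by
        rw [one_mul]; exact pow_le_pow_of_le_one (by norm_num) (by norm_num) h2
    _ = _ := pow_add _ _ _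

theorem spread_summable (hφ : StrictMono φ) (u : ℝ) :
    Summable fun m => (binDigit u m : ℝ) * (1 / 2) ^ φ (m + 1) :=
  Summable.of_nonneg_of_le (spread_term_nonneg u) (fun m => spread_term_le hφ u 0 m)
    (summable_geometric_two.mul_left _)

theorem spreadSum_le_spread (hφ : StrictMono φ) (u : ℝ) (n : ℕ) :
    spreadSum φ u n ≤ spread φ u :=
  (spread_summable hφ u).sum_le_tsum _ fun m _ => spread_term_nonneg u m

theorem spread_le_spreadSum_add (hφ : StrictMono φ) (u : ℝ) (n : ℕ) :
    spread φ u ≤ spreadSum φ u n + 2 * (1 / 2) ^ φ (n + 1) := by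
  have hs := spread_summable hφ u
  have h1 := hs.sum_add_tsum_nat_add n
  have h2 : ∑' m, (binDigit u (m + n) : ℝ) * (1 / 2) ^ φ (m + n + 1) ≤
      ∑' m : ℕ, (1 / 2) ^ φ (n + 1) * (1 / 2 : ℝ) ^ m :=
    ((summable_nat_add_iff n).2 hs).tsum_le_tsum (fun m => spread_term_le hφ u n m)
      (summable_geometric_two.mul_left _)
  rw [tsum_mul_left, tsum_geometric_two] at h2
  unfold spread spreadSum
  linarith

theorem spread_le_spreadSum_add' (hφ : StrictMono φ) (u : ℝ) (n : ℕ) :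
    spread φ u ≤ spreadSum φ u n + (1 / 2) ^ φ n := by
  have h1 := spread_le_spreadSum_add hφ u n
  have h2 : (1 / 2 : ℝ) ^ φ (n + 1) ≤ (1 / 2) ^ (φ n + 1) :=
    pow_le_pow_of_le_one (by norm_num) (by norm_num) (hφ (Nat.lt_succ_self n))
  rw [pow_succ] at h2
  linarith

theorem spread_nonneg (u : ℝ) : 0 ≤ spread φ u := tsum_nonneg (spread_term_nonneg u)

theorem spread_le_one (hφ : StrictMono φ) (u : ℝ) : spread φ u ≤ 1 := by
  have h := spread_le_spreadSum_add' hφ u 0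
  have : (1 / 2 : ℝ) ^ φ 0 ≤ 1 := pow_le_one₀ (by norm_num) (by norm_num)
  simp only [spreadSum, Finset.range_zero, Finset.sum_empty] at h
  linarith

theorem exists_int_spreadSum (hφ : StrictMono φ) (u : ℝ) (n : ℕ) :
    ∃ K : ℤ, 0 ≤ K ∧ spreadSum φ u n = K * (1 / 2) ^ φ n := by
  induction n with
  | zero => exact ⟨0, le_rfl, by simp [spreadSum]⟩
  | succ n ih =>
    obtain ⟨K, hK0, hK⟩ := ih
    have hlt : φ n < φ (n + 1) := hφ (Nat.lt_succ_self n)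
    refine ⟨K * 2 ^ (φ (n + 1) - φ n) + binDigit u n,
      add_nonneg (by positivity) (binDigit_nonneg u n), ?_⟩
    rw [spreadSum, Finset.sum_range_succ, ← spreadSum, hK]
    have : (1 / 2 : ℝ) ^ φ n = 2 ^ (φ (n + 1) - φ n) * (1 / 2) ^ φ (n + 1) := by
      conv_rhs => rw [← Nat.sub_add_cancel hlt.le, pow_add, ← mul_assoc, Nat.sub_add_cancel hlt.le,
        ← mul_pow]
      norm_num
    rw [this]; push_cast; ring

/-- Spreading does not shrink a difference of truncations below `2^{-φ n}` per unit. In the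
induction, the doubling of the integer difference is compensated by `2 * 2^{-φ (n+1)} ≤ 2^{-φ n}`.
-/
theorem floor_mul_le_spreadSum_sub (hφ : StrictMono φ) {u v : ℝ} (hv : 0 ≤ v) (hvu : v ≤ u)
    (hu : u < 1) (n : ℕ) :
    ((⌊(2 : ℝ) ^ n * u⌋ - ⌊(2 : ℝ) ^ n * v⌋ : ℤ) : ℝ) * (1 / 2) ^ φ n ≤
      spreadSum φ u n - spreadSum φ v n := by
  induction n with
  | zero =>
    have h1 : ⌊u⌋ = 0 := Int.floor_eq_zero_iff.2 ⟨hv.trans hvu, hu⟩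
    have h2 : ⌊v⌋ = 0 := Int.floor_eq_zero_iff.2 ⟨hv, hvu.trans_lt hu⟩
    simp [h1, h2, spreadSum]
  | succ n ih =>
    have hU : ⌊(2 : ℝ) ^ (n + 1) * u⌋ = 2 * ⌊(2 : ℝ) ^ n * u⌋ + binDigit u n := by
      unfold binDigit; ring
    have hV : ⌊(2 : ℝ) ^ (n + 1) * v⌋ = 2 * ⌊(2 : ℝ) ^ n * v⌋ + binDigit v n := by
      unfold binDigit; ring
    have hpow : 2 * (1 / 2 : ℝ) ^ φ (n + 1) ≤ (1 / 2) ^ φ n := by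
      have : (1 / 2 : ℝ) ^ φ (n + 1) ≤ (1 / 2) ^ (φ n + 1) :=
        pow_le_pow_of_le_one (by norm_num) (by norm_num) (hφ (Nat.lt_succ_self n))
      rw [pow_succ] at this; linarith
    have hfl : (0 : ℝ) ≤ ((⌊(2 : ℝ) ^ n * u⌋ - ⌊(2 : ℝ) ^ n * v⌋ : ℤ) : ℝ) := by
      have : ⌊(2 : ℝ) ^ n * v⌋ ≤ ⌊(2 : ℝ) ^ n * u⌋ := Int.floor_le_floor (by gcongr)
      exact_mod_cast sub_nonneg.2 this
    have key := mul_le_mul_of_nonneg_left hpow hfl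
    rw [spreadSum, spreadSum, Finset.sum_range_succ, Finset.sum_range_succ, ← spreadSum,
      ← spreadSum, hU, hV]
    push_cast at ih key ⊢
    linarith

/-- The factor 2 makes the truncations differ by two units: one pays for the tail of `v`, the other
remains. -/
theorem le_spread_sub (hφ : StrictMono φ) {u v : ℝ} (hv : 0 ≤ v) (hu : u < 1) (n : ℕ)
    (h : 2 * (1 / 2) ^ n ≤ u - v) : (1 / 2 : ℝ) ^ φ n ≤ spread φ u - spread φ v := by
  have hvu : v ≤ u := by
    have : (0 : ℝ) ≤ 2 * (1 / 2) ^ n := by positivity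
    linarith
  have h1 := floor_mul_le_spreadSum_sub hφ hv hvu hu n
  have h2 : (2 : ℤ) ≤ ⌊(2 : ℝ) ^ n * u⌋ - ⌊(2 : ℝ) ^ n * v⌋ := by
    have : ⌊(2 : ℝ) ^ n * v⌋ + 2 ≤ ⌊(2 : ℝ) ^ n * u⌋ := by
      rw [Int.le_floor]
      push_cast
      have h3 := Int.floor_le ((2 : ℝ) ^ n * v)
      have h4 : (2 : ℝ) ^ n * (2 * (1 / 2) ^ n) ≤ 2 ^ n * (u - v) := by gcongr
      have h5 : (2 : ℝ) ^ n * (2 * (1 / 2) ^ n) = 2 := by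
        rw [mul_left_comm, ← mul_pow]; norm_num
      linarith
    omega
  have h3 : (2 : ℝ) ≤ ((⌊(2 : ℝ) ^ n * u⌋ - ⌊(2 : ℝ) ^ n * v⌋ : ℤ) : ℝ) := by exact_mod_cast h2
  have h4 : (2 : ℝ) * (1 / 2) ^ φ n ≤
      ((⌊(2 : ℝ) ^ n * u⌋ - ⌊(2 : ℝ) ^ n * v⌋ : ℤ) : ℝ) * (1 / 2) ^ φ n := by gcongr
  have h5 := spread_le_spreadSum_add' hφ v n
  have h6 := spreadSum_le_spread hφ u n
  linarith

/-- The inverse of `spread φ` is Hölder continuous of exponent `1 / A` if `φ` grows at most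
like `A n`. -/
theorem exists_abs_sub_le_spread (hφ : StrictMono φ) {A C : ℝ} (hA : 0 < A)
    (hC : ∀ n : ℕ, (φ n : ℝ) ≤ A * n + C) :
    ∃ D : ℝ, 0 ≤ D ∧ ∀ u v : ℝ, 0 ≤ u → u < 1 → 0 ≤ v → v < 1 →
      |u - v| ≤ D * |spread φ u - spread φ v| ^ (1 / A) := by
  refine ⟨4 * 2 ^ (C / A), by positivity, fun u v hu0 hu1 hv0 hv1 => ?_⟩
  wlog huv : v ≤ u generalizing u v
  · rw [abs_sub_comm, abs_sub_comm (spread φ u)]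
    exact this v u hv0 hv1 hu0 hu1 (not_le.1 huv).le
  rcases huv.eq_or_lt with rfl | hlt
  · simp only [sub_self, abs_zero]; positivity
  rw [abs_of_nonneg (sub_nonneg.2 huv)]
  -- `n` is such that `2^{-(n+1)} < (u - v)/2 ≤ 2^{-n}`. The first inequality allows `le_spread_sub`
  -- at `n + 1`, the second gives the factor 4.
  obtain ⟨n, hn1, hn2⟩ := exists_nat_pow_near_of_lt_one (x := (u - v) / 2) (by linarith)
    (by linarith) (y := (1 / 2 : ℝ)) (by norm_num) (by norm_num)
  have h1 := le_spread_sub hφ hv0 hu1 (n + 1) (by linarith)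
  have h2 : (1 / 2 : ℝ) ^ (A * ((n + 1 : ℕ) : ℝ) + C) ≤ |spread φ u - spread φ v| := by
    refine le_trans ?_ (h1.trans (le_abs_self _))
    rw [← Real.rpow_natCast]
    exact Real.rpow_le_rpow_of_exponent_ge (by norm_num) (by norm_num) (hC (n + 1))
  have h3 : (1 / 2 : ℝ) ^ (((n + 1 : ℕ) : ℝ) + C / A) ≤
      |spread φ u - spread φ v| ^ (1 / A) := by
    calc _ = ((1 / 2 : ℝ) ^ (A * ((n + 1 : ℕ) : ℝ) + C)) ^ (1 / A) := by
          rw [← Real.rpow_mul (by norm_num)]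
          congr 1; field_simp
      _ ≤ _ := by gcongr
  have h4 : (1 / 2 : ℝ) ^ (((n + 1 : ℕ) : ℝ) + C / A) = (1 / 2) ^ (n + 1) * (2 ^ (C / A))⁻¹ := by
    rw [Real.rpow_add (by norm_num), Real.rpow_natCast]
    congr 1
    rw [one_div, Real.inv_rpow (by norm_num)]
  rw [h4] at h3
  have hpos : (0 : ℝ) < 2 ^ (C / A) := by positivity
  calc u - v ≤ 4 * (1 / 2) ^ (n + 1) := by rw [pow_succ]; linarith
    _ = 4 * 2 ^ (C / A) * ((1 / 2) ^ (n + 1) * (2 ^ (C / A))⁻¹) := by field_simp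
    _ ≤ _ := by gcongr

end Spread

/-! ### Hausdorff dimension -/

/-- The inverse of `X` on `U` is `r`-Hölder, so it divides dimensions by at worst `r` and the
preimage has dimension less than `d`. For the sup norm the `d`-dimensional Hausdorff measure is
Lebesgue measure. No regularity of `X` itself is needed. -/
theorem volume_inter_preimage_eq_zero {d : ℕ} {X : (Fin d → ℝ) → Fin d → ℝ}
    {U S : Set (Fin d → ℝ)} {r C : ℝ} (hr : 0 < r) (hC : 0 ≤ C)
    (hX : ∀ u ∈ U, ∀ v ∈ U, dist u v ≤ C * dist (X u) (X v) ^ r)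
    (hS : dimH S < ENNReal.ofReal (r * d)) : volume (U ∩ X ⁻¹' S) = 0 := by
  set V := U ∩ X ⁻¹' S with hV
  have hinj : InjOn X V := by
    intro u hu v hv huv
    have := hX u hu.1 v hv.1
    rw [huv, dist_self, Real.zero_rpow hr.ne', mul_zero] at this
    exact dist_le_zero.1 this
  set g := Function.invFunOn X V
  have hg : ∀ u ∈ V, g (X u) = u := hinj.leftInvOn_invFunOn
  have hold : HolderOnWith C.toNNReal r.toNNReal g (X '' V) := by
    rintro _ ⟨u, hu, rfl⟩ _ ⟨v, hv, rfl⟩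
    rw [hg u hu, hg v hv, edist_dist, edist_dist, Real.coe_toNNReal r hr.le,
      ENNReal.ofReal_rpow_of_nonneg dist_nonneg hr.le]
    change _ ≤ ENNReal.ofReal C * _
    rw [← ENNReal.ofReal_mul hC]
    exact ENNReal.ofReal_le_ofReal (hX u hu.1 v hv.1)
  have himg : g '' (X '' V) = V := by
    rw [image_image]
    exact (image_congr hg).trans (image_id' V)
  have hr' : 0 < r.toNNReal := Real.toNNReal_pos.2 hr
  have h1 := hold.dimH_image_le hr'
  rw [himg] at h1
  have h2 : dimH (X '' V) ≤ dimH S := dimH_mono (by rintro _ ⟨u, hu, rfl⟩; exact hu.2)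
  have h3 : dimH V < ((d : NNReal) : ℝ≥0∞) := by
    refine h1.trans_lt ?_
    rw [ENNReal.div_lt_iff (Or.inl (by exact_mod_cast hr'.ne')) (Or.inl ENNReal.coe_ne_top)]
    refine h2.trans_lt (hS.trans_le ?_)
    rw [mul_comm, ENNReal.ofReal_mul (by positivity), ENNReal.ofReal_natCast]
    rfl
  have h4 := hausdorffMeasure_of_dimH_lt h3
  have h5 : (μH[((d : NNReal) : ℝ)] : Measure (Fin d → ℝ)) = volume := by
    rw [← hausdorffMeasure_pi_real]; simp
  rwa [h5] at h4

theorem volume_eq_zero_of_dimH_lt {d : ℕ} {S : Set (Fin d → ℝ)} (hS : dimH S < d) :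
    volume S = 0 := by
  have h := volume_inter_preimage_eq_zero (X := id) (U := univ) (S := S) one_pos zero_le_one
    (fun u _ v _ => by simp) (by simpa using hS)
  simpa using h

/-- A limsup set has dimension at most `t` if the `t`-th powers of the diameters are summable. -/
theorem dimH_le_of_frequently_mem {X ι : Type*} [EMetricSpace X] [Countable ι] {t : NNReal}
    {A : Set X} (V : ℕ → ι → Set X) {r : ℕ → ℝ≥0∞} (hr : Antitone r)
    (hr0 : Tendsto r atTop (𝓝 0)) (hV : ∀ j i, Metric.ediam (V j i) ≤ r j)
    (hsum : ∑' z : ℕ × ι, Metric.ediam (V z.1 z.2) ^ (t : ℝ) ≠ ∞)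
    (hA : ∀ x ∈ A, ∃ᶠ j in atTop, ∃ i, x ∈ V j i) : dimH A ≤ t := by
  borelize X
  refine dimH_le_of_hausdorffMeasure_ne_top (ne_top_of_le_ne_top hsum ?_)
  refine (Measure.hausdorffMeasure_le_liminf_tsum (ι := fun n => {j : ℕ // n ≤ j} × ι) (l := atTop)
    t A r hr0 (fun n z => V z.1 z.2) ?_ ?_).trans ?_
  · exact Eventually.of_forall fun n z => (hV _ _).trans (hr z.1.2)
  · refine Eventually.of_forall fun n x hx => ?_
    obtain ⟨j, hj, i, hi⟩ := frequently_atTop.1 (hA x hx) n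
    exact mem_iUnion.2 ⟨(⟨j, hj⟩, i), hi⟩
  · refine (liminf_le_liminf (v := fun _ => ∑' z : ℕ × ι, Metric.ediam (V z.1 z.2) ^ (t : ℝ))
      (Eventually.of_forall fun n => ?_)).trans_eq (by simp)
    exact ENNReal.tsum_comp_le_tsum_of_injective
      (f := fun z : {j : ℕ // n ≤ j} × ι => ((z.1 : ℕ), z.2))
      (by rintro ⟨a, b⟩ ⟨a', b'⟩ h; simp only [Prod.mk.injEq] at h; ext1; exacts [Subtype.ext h.1, h.2])
      (fun z : ℕ × ι => Metric.ediam (V z.1 z.2) ^ (t : ℝ))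

variable {𝕜 : Type*} [RCLike 𝕜] {d N : ℕ}

/-! ### Discrete Besov spaces -/

theorem toReal_mul_dimOver {p : ℝ≥0∞} (hp : 0 < p) (hp' : p ≠ ∞) :
    p.toReal * dimOver d p = d := by
  have : 0 < p.toReal := ENNReal.toReal_pos hp.ne' hp'
  rw [dimOver, ENNReal.toReal_div, ENNReal.toReal_natCast]
  field_simp

theorem dimOver_nonneg (d : ℕ) (p : ℝ≥0∞) : 0 ≤ dimOver d p := ENNReal.toReal_nonneg

theorem dimOver_top : dimOver d ∞ = 0 := by simp [dimOver]

section BesovBounds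

variable {s : ℝ} {p q : ℝ≥0∞} {c : Coeffs 𝕜 d N}

/-- The upper bounds use `q` only through `ℓ^q ⊆ ℓ^∞`. -/
theorem InBesov.exists_norm_le (hc : InBesov s p q c) :
    ∃ h : ∀ j, Memℓp (besovLevel s p c j) p, ∃ E : ℝ, 0 ≤ E ∧ ∀ j,
      ‖(⟨besovLevel s p c j, h j⟩ : lp (fun _ : Fin N × (Fin d → ℤ) => ℝ) p)‖ ≤ E := by
  obtain ⟨h, hm⟩ := hc
  obtain ⟨E, hE⟩ := memℓp_infty_iff.1 (hm.of_exponent_ge le_top)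
  refine ⟨h, E, ?_, fun j => ?_⟩
  · exact (abs_nonneg _).trans (hE ⟨0, rfl⟩)
  · refine le_trans (le_abs_self _) (hE ⟨j, rfl⟩)

theorem InBesov.exists_le (hp : 0 < p) (hc : InBesov s p q c) :
    ∃ E : ℝ, 0 ≤ E ∧ ∀ i j k, ‖c i j k‖ ≤ E * 2 ^ ((dimOver d p - s) * (j : ℝ)) := by
  obtain ⟨h, E, hE0, hE⟩ := hc.exists_norm_le
  refine ⟨E, hE0, fun i j k => ?_⟩
  have h1 := (lp.norm_apply_le_norm hp.ne'
    (⟨besovLevel s p c j, h j⟩ : lp (fun _ : Fin N × (Fin d → ℤ) => ℝ) p) (i, k)).trans (hE j)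
  have h2 : ‖c i j k‖ * (2 : ℝ) ^ ((s - dimOver d p) * (j : ℝ)) ≤ E :=
    (le_abs_self _).trans h1
  have h3 : ‖c i j k‖ = ‖c i j k‖ * (2 : ℝ) ^ ((s - dimOver d p) * (j : ℝ)) *
      2 ^ ((dimOver d p - s) * (j : ℝ)) := by
    rw [mul_assoc, ← Real.rpow_add two_pos]
    ring_nf; simp
  rw [h3]
  gcongr

theorem InBesov.exists_tsum_le (hp : 0 < p) (hp' : p ≠ ∞) (hc : InBesov s p q c) :
    ∃ E : ℝ, 0 ≤ E ∧ ∀ j : ℕ, ∑' ik : Fin N × (Fin d → ℤ),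
      ENNReal.ofReal (‖c ik.1 j ik.2‖ ^ p.toReal) ≤
        ENNReal.ofReal (E * 2 ^ ((d - s * p.toReal) * (j : ℝ))) := by
  obtain ⟨h, E, hE0, hE⟩ := hc.exists_norm_le
  have hP : 0 < p.toReal := ENNReal.toReal_pos hp.ne' hp'
  refine ⟨E ^ p.toReal, by positivity, fun j => ?_⟩
  have h1 := Real.rpow_le_rpow (lp.norm_nonneg' _) (hE j) hP.le
  rw [lp.norm_rpow_eq_tsum hP] at h1
  have hs := (h j).summable hP
  have h3 : ∀ ik : Fin N × (Fin d → ℤ), ‖c ik.1 j ik.2‖ ^ p.toReal =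
      2 ^ ((d - s * p.toReal) * (j : ℝ)) * ‖besovLevel s p c j ik‖ ^ p.toReal := by
    intro ik
    rw [besovLevel, Real.norm_eq_abs, abs_of_nonneg (by positivity),
      Real.mul_rpow (norm_nonneg _) (by positivity), ← Real.rpow_mul zero_le_two, mul_left_comm,
      ← Real.rpow_add two_pos]
    have : (d - s * p.toReal) * (j : ℝ) + (s - dimOver d p) * j * p.toReal = 0 := by
      rw [← toReal_mul_dimOver hp hp' (d := d)]; ring
    rw [this, Real.rpow_zero, mul_one]
  simp_rw [h3]
  rw [← ENNReal.ofReal_tsum_of_nonneg (fun _ => by positivity) (hs.mul_left _), tsum_mul_left,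
    mul_comm]
  apply ENNReal.ofReal_le_ofReal
  gcongr

end BesovBounds

/-- A quasi-triangle inequality valid also for `p < 1`. Its constant does not depend on the
sequences, so it can be applied uniformly in the scale. -/
theorem lp_norm_le_of_le_add {ι : Type*} {p : ℝ≥0∞} (hp : 0 < p) : ∃ K : ℝ, 0 ≤ K ∧
    ∀ f g h : lp (fun _ : ι => ℝ) p, (∀ i, ‖f i‖ ≤ ‖g i‖ + ‖h i‖) → ‖f‖ ≤ K * (‖g‖ + ‖h‖) := by
  obtain (rfl | rfl | hP) := p.trichotomy
  · exact absurd hp (lt_irrefl _)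
  · refine ⟨1, zero_le_one, fun f g h hfg => ?_⟩
    rw [one_mul]
    exact lp.norm_le_of_forall_le (by positivity) fun i => (hfg i).trans
      (add_le_add (lp.norm_apply_le_norm hp.ne' g i) (lp.norm_apply_le_norm hp.ne' h i))
  · set P := p.toReal
    have hadd : ∀ a b : ℝ, 0 ≤ a → 0 ≤ b → (a + b) ^ P ≤ 2 ^ P * (a ^ P + b ^ P) := by
      intro a b ha hb
      rw [mul_add, ← Real.mul_rpow zero_le_two ha, ← Real.mul_rpow zero_le_two hb]
      rcases le_total a b with hab | hab
      · have : (a + b) ^ P ≤ (2 * b) ^ P := Real.rpow_le_rpow (by positivity) (by linarith) hP.le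
        have : 0 ≤ (2 * a) ^ P := by positivity
        linarith
      · have : (a + b) ^ P ≤ (2 * a) ^ P := Real.rpow_le_rpow (by positivity) (by linarith) hP.le
        have : 0 ≤ (2 * b) ^ P := by positivity
        linarith
    refine ⟨(2 ^ P * 2) ^ P⁻¹, by positivity, fun f g h hfg => ?_⟩
    have hgh : 0 ≤ ‖g‖ + ‖h‖ := add_nonneg (lp.norm_nonneg' g) (lp.norm_nonneg' h)
    refine lp.norm_le_of_forall_sum_le hP (by positivity) fun t => ?_
    rw [Real.mul_rpow (by positivity) hgh, Real.rpow_inv_rpow (by positivity) hP.ne']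
    calc ∑ i ∈ t, ‖f i‖ ^ P ≤ ∑ i ∈ t, 2 ^ P * (‖g i‖ ^ P + ‖h i‖ ^ P) := by
          gcongr with i
          exact (Real.rpow_le_rpow (norm_nonneg _) (hfg i) hP.le).trans
            (hadd _ _ (norm_nonneg _) (norm_nonneg _))
      _ = 2 ^ P * (∑ i ∈ t, ‖g i‖ ^ P + ∑ i ∈ t, ‖h i‖ ^ P) := by
          rw [← Finset.mul_sum, Finset.sum_add_distrib]
      _ ≤ 2 ^ P * (‖g‖ ^ P + ‖h‖ ^ P) := by
          gcongr
          exacts [lp.sum_rpow_le_norm_rpow hP g t, lp.sum_rpow_le_norm_rpow hP h t]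
      _ ≤ 2 ^ P * ((‖g‖ + ‖h‖) ^ P + (‖g‖ + ‖h‖) ^ P) := by
          have := lp.norm_nonneg' g
          have := lp.norm_nonneg' h
          gcongr <;> linarith
      _ = 2 ^ P * 2 * (‖g‖ + ‖h‖) ^ P := by ring

theorem InBesov.add {s : ℝ} {p q : ℝ≥0∞} {c c' : Coeffs 𝕜 d N} (hp : 0 < p)
    (hc : InBesov s p q c) (hc' : InBesov s p q c') : InBesov s p q (c + c') := by
  obtain ⟨h, hm⟩ := hc
  obtain ⟨h', hm'⟩ := hc'
  have hle : ∀ j ik, ‖besovLevel s p (c + c') j ik‖ ≤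
      ‖besovLevel s p c j ik‖ + ‖besovLevel s p c' j ik‖ := by
    intro j ik
    simp only [besovLevel, Pi.add_apply, norm_mul, norm_norm, ← add_mul]
    gcongr
    exact norm_add_le _ _
  have h'' : ∀ j, Memℓp (besovLevel s p (c + c') j) p := fun j =>
    ((h j).norm.add (h' j).norm).mono (hle j)
  obtain ⟨K, hK0, hK⟩ := lp_norm_le_of_le_add (ι := Fin N × (Fin d → ℤ)) hp
  refine ⟨h'', ((hm.add hm').const_mul K).mono fun j => ?_⟩
  refine (abs_of_nonneg (lp.norm_nonneg' _)).trans_le ?_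
  exact hK ⟨_, h'' j⟩ ⟨_, h j⟩ ⟨_, h' j⟩ (hle j)

/-! ### Divergence exponents -/

theorem eventually_mul_two_rpow_lt {a b : ℝ} (hab : a < b) (C : ℝ) :
    ∀ᶠ j : ℕ in atTop, C * (2 : ℝ) ^ (a * (j : ℝ)) < 2 ^ (b * (j : ℝ)) := by
  have h : Tendsto (fun j : ℕ => ((2 : ℝ) ^ (b - a)) ^ j) atTop atTop :=
    tendsto_pow_atTop_atTop_of_one_lt (Real.one_lt_rpow one_lt_two (sub_pos.2 hab))
  filter_upwards [h.eventually_gt_atTop C] with j hj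
  rw [← Real.rpow_natCast, ← Real.rpow_mul zero_le_two] at hj
  calc C * (2 : ℝ) ^ (a * (j : ℝ)) < 2 ^ ((b - a) * (j : ℝ)) * 2 ^ (a * (j : ℝ)) := by gcongr
    _ = 2 ^ (b * (j : ℝ)) := by rw [← Real.rpow_add two_pos]; ring_nf

section Exponent

variable {ψ : Fin N → (Fin d → ℝ) → 𝕜} {c : Coeffs 𝕜 d N} {x : Fin d → ℝ} {γ : ℝ}

/-- The constant of `DivergesAtRate` is absorbed by passing to a strictly smaller rate. -/
theorem frequently_of_lt_divExponent (h : (γ : EReal) < divExponent ψ c x) :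
    ∃ᶠ j : ℕ in atTop, ∃ i k, (2 : ℝ) ^ (γ * (j : ℝ)) ≤ ‖c i j k * wavelet ψ i j k x‖ := by
  obtain ⟨_, ⟨γ', ⟨C, hC, i, j, k, hj, hle⟩, rfl⟩, hlt⟩ := lt_sSup_iff.1 h
  have h1 := (eventually_mul_two_rpow_lt (EReal.coe_lt_coe_iff.1 hlt) C⁻¹)
  refine hj.frequently (Eventually.frequently ?_)
  filter_upwards [hj.eventually h1] with n hn
  refine ⟨i n, k n, le_trans ?_ (hle n)⟩
  rw [inv_mul_lt_iff₀ hC] at hn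
  exact hn.le

theorem le_divExponent_of_frequently
    (h : ∃ᶠ j : ℕ in atTop, ∃ i k, (2 : ℝ) ^ (γ * (j : ℝ)) ≤ ‖c i j k * wavelet ψ i j k x‖) :
    (γ : EReal) ≤ divExponent ψ c x := by
  obtain ⟨j, hj, h'⟩ := exists_seq_forall_of_frequently h
  choose i k hik using h'
  exact le_sSup ⟨γ, ⟨1, one_pos, i, j, k, hj, fun n => by rw [one_mul]; exact hik n⟩, rfl⟩

theorem le_divExponent_of_forall_lt (h : ∀ γ' < γ, ∃ᶠ j : ℕ in atTop, ∃ i k,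
    (2 : ℝ) ^ (γ' * (j : ℝ)) ≤ ‖c i j k * wavelet ψ i j k x‖) :
    (γ : EReal) ≤ divExponent ψ c x := by
  by_contra! hlt
  obtain ⟨γ', h1, h2⟩ := EReal.lt_iff_exists_real_btwn.1 hlt
  exact absurd (le_divExponent_of_frequently (h γ' (EReal.coe_lt_coe_iff.1 h2))) (not_le.2 h1)

theorem IsWaveletSystem.exists_bound (hψ : IsWaveletSystem ψ) :
    ∃ B : ℝ, 0 < B ∧ ∀ i x, ‖ψ i x‖ ≤ B := by
  choose B hB using fun i => (hψ i).1
  refine ⟨1 + ∑ i, |B i|, by positivity, fun i x => (hB i x).trans ((le_abs_self _).trans ?_)⟩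
  have := Finset.single_le_sum (f := fun i => |B i|) (fun i _ => abs_nonneg _) (Finset.mem_univ i)
  linarith

theorem IsWaveletSystem.exists_decay (hψ : IsWaveletSystem ψ) (n : ℕ) :
    ∃ B : ℝ, 0 < B ∧ ∀ i x, ‖ψ i x‖ * (1 + ‖x‖) ^ n ≤ B := by
  choose B hB using fun i => (hψ i).2 n
  refine ⟨1 + ∑ i, |B i|, by positivity, fun i x => ?_⟩
  have h := hB i x
  rw [le_div_iff₀ (by positivity)] at h
  refine h.trans ((le_abs_self _).trans ?_)
  have := Finset.single_le_sum (f := fun i => |B i|) (fun i _ => abs_nonneg _) (Finset.mem_univ i)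
  linarith

variable {s : ℝ} {p q : ℝ≥0∞}

theorem divExponent_le (hψ : IsWaveletSystem ψ) (hp : 0 < p) (hc : InBesov s p q c)
    (x : Fin d → ℝ) : divExponent ψ c x ≤ ((dimOver d p - s : ℝ) : EReal) := by
  by_contra! hlt
  obtain ⟨γ, h1, h2⟩ := EReal.lt_iff_exists_real_btwn.1 hlt
  obtain ⟨B, hB0, hB⟩ := hψ.exists_bound
  obtain ⟨E, hE0, hE⟩ := hc.exists_le hp
  obtain ⟨j, ⟨i, k, hik⟩, hj⟩ := ((frequently_of_lt_divExponent h2).and_eventually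
    (eventually_mul_two_rpow_lt (EReal.coe_lt_coe_iff.1 h1) (E * B))).exists
  refine absurd (hik.trans ?_) (not_le.2 hj)
  rw [norm_mul, mul_right_comm]
  exact mul_le_mul (hE i j k) (hB _ _) (norm_nonneg _) (by positivity)

/-- At points of large divergence exponent, the coefficients near the point are large. -/
theorem frequently_near_of_lt_divExponent (hψ : IsWaveletSystem ψ) (hp : 0 < p)
    (hc : InBesov s p q c) {B : ℝ} (hB : ∀ i x, ‖ψ i x‖ ≤ B) {ε : ℝ} (hε : 0 < ε)
    (h : (γ : EReal) < divExponent ψ c x) :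
    ∃ᶠ j : ℕ in atTop, ∃ i k, (2 : ℝ) ^ (γ * (j : ℝ)) ≤ B * ‖c i j k‖ ∧
      ‖fun a => (2 : ℝ) ^ j * x a - (k a : ℝ)‖ ≤ 2 ^ (ε * (j : ℝ)) := by
  obtain ⟨E, hE0, hE⟩ := hc.exists_le hp
  -- With `n ε > d/p - s - γ`, decay of order `n` at distance `2^{εj}` makes even the largest
  -- possible coefficient contribute less than `2^{γj}`.
  obtain ⟨n, hn⟩ := exists_nat_gt ((dimOver d p - s - γ) / ε)
  rw [div_lt_iff₀ hε] at hn
  obtain ⟨D, hD0, hD⟩ := hψ.exists_decay n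
  refine ((frequently_of_lt_divExponent h).and_eventually (eventually_mul_two_rpow_lt
    (show dimOver d p - s < γ + n * ε by linarith) (E * D))).mono ?_
  rintro j ⟨⟨i, k, hik⟩, hj⟩
  rw [norm_mul] at hik
  refine ⟨i, k, hik.trans ?_, ?_⟩
  · rw [mul_comm]
    exact mul_le_mul_of_nonneg_right (hB _ _) (norm_nonneg _)
  by_contra! hlt
  set y : Fin d → ℝ := fun a => (2 : ℝ) ^ j * x a - (k a : ℝ) with hy
  have h1 : ((2 : ℝ) ^ (ε * (j : ℝ))) ^ n ≤ (1 + ‖y‖) ^ n := by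
    gcongr; linarith
  have h2 : ‖wavelet ψ i j k x‖ * ((2 : ℝ) ^ (ε * (j : ℝ))) ^ n ≤ D :=
    (mul_le_mul_of_nonneg_left h1 (norm_nonneg _)).trans (hD i y)
  refine absurd ?_ (not_le.2 hj)
  calc (2 : ℝ) ^ ((γ + n * ε) * (j : ℝ)) =
        2 ^ (γ * (j : ℝ)) * ((2 : ℝ) ^ (ε * (j : ℝ))) ^ n := by
        rw [← Real.rpow_natCast, ← Real.rpow_mul zero_le_two, ← Real.rpow_add two_pos]; ring_nf
    _ ≤ ‖c i j k‖ * ‖wavelet ψ i j k x‖ * ((2 : ℝ) ^ (ε * (j : ℝ))) ^ n := by gcongr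
    _ = ‖c i j k‖ * (‖wavelet ψ i j k x‖ * ((2 : ℝ) ^ (ε * (j : ℝ))) ^ n) := by ring
    _ ≤ E * 2 ^ ((dimOver d p - s) * (j : ℝ)) * D :=
        mul_le_mul (hE i j k) h2 (by positivity) (by positivity)
    _ = _ := by ring

/-- A covering argument: only balls around positions of large coefficients are needed, and the `ℓ^p`
bound at scale `j` controls their number. -/
theorem dimH_le_divExponent_le (hψ : IsWaveletSystem ψ) (hp : 0 < p) (hp' : p ≠ ∞)
    (hc : InBesov s p q c) (γ : ℝ) :
    dimH {x | (γ : EReal) ≤ divExponent ψ c x} ≤ ENNReal.ofReal (d - p.toReal * (s + γ)) := by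
  have hP : 0 < p.toReal := ENNReal.toReal_pos hp.ne' hp'
  set P := p.toReal with hPdef
  obtain ⟨B, hB0, hB⟩ := hψ.exists_bound
  obtain ⟨E, hE0, hE⟩ := hc.exists_tsum_le hp hp'
  refine le_of_forall_gt_imp_ge_of_dense fun t' ht' => ?_
  rcases eq_or_ne t' ∞ with rfl | htop
  · exact le_top
  lift t' to NNReal using htop
  set t : ℝ := NNReal.toReal t' with ht
  have hlt : d - P * (s + γ) < t := by
    by_contra! h
    exact absurd (ENNReal.ofReal_le_ofReal h) (not_le.2 (by rwa [ht, ENNReal.ofReal_coe_nnreal]))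
  have ht0 : 0 < t := by
    have : (0 : ℝ≥0∞) < t' := zero_le.trans_lt ht'
    exact_mod_cast this
  set g := t - (d - P * (s + γ)) with hg
  have hg0 : 0 < g := by rw [hg]; linarith
  -- The reserve `g` is spent as `g/4` on lowering `γ` and at most `g/4` on widening the balls,
  -- leaving the exponent `a ≤ -g/2`. The bound `ε ≤ 1/2` makes the diameters tend to 0.
  set γ' := γ - g / (4 * P) with hγ'
  set ε := min (1 / 2) (g / (4 * t)) with hε
  have hε0 : 0 < ε := by positivity
  have hε1 : ε ≤ 1 / 2 := min_le_left _ _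
  have hε2 : ε * t ≤ g / 4 := by
    calc ε * t ≤ g / (4 * t) * t := by gcongr; exact min_le_right _ _
      _ = g / 4 := by field_simp
  have hPγ : P * γ' = P * γ - g / 4 := by rw [hγ']; field_simp
  set a := (d - s * P) - γ' * P + (ε - 1) * t with ha
  have ha0 : a < 0 := by rw [ha]; nlinarith
  classical
  let V : ℕ → Fin N × (Fin d → ℤ) → Set (Fin d → ℝ) := fun j ik =>
    if (2 : ℝ) ^ (γ' * (j : ℝ)) ≤ B * ‖c ik.1 j ik.2‖ then
      {x | ‖fun a => (2 : ℝ) ^ j * x a - (ik.2 a : ℝ)‖ ≤ 2 ^ (ε * (j : ℝ))} else ∅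
  let ρ : ℕ → ℝ := fun j => 2 * ((2 : ℝ) ^ (ε - 1)) ^ j
  have hρ1 : (2 : ℝ) ^ (ε - 1) < 1 := Real.rpow_lt_one_of_one_lt_of_neg one_lt_two (by linarith)
  have hV : ∀ j ik, Metric.ediam (V j ik) ≤ ENNReal.ofReal (ρ j) := by
    intro j ik
    simp only [V]
    split_ifs
    · refine Metric.ediam_le fun x hx y hy => ?_
      rw [edist_dist]
      refine ENNReal.ofReal_le_ofReal ((dist_pi_le_iff (by positivity)).2 fun b => ?_)
      have h1 := (norm_le_pi_norm _ b).trans hx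
      have h2 := (norm_le_pi_norm _ b).trans hy
      have h3 : (2 : ℝ) ^ j * ρ j = 2 * 2 ^ (ε * (j : ℝ)) := by
        simp only [ρ]
        rw [← Real.rpow_natCast 2 j, ← Real.rpow_natCast, ← Real.rpow_mul zero_le_two,
          mul_left_comm, ← Real.rpow_add two_pos]
        ring_nf
      rw [Real.norm_eq_abs] at h1 h2
      rw [Real.dist_eq]
      have h4 : (2 : ℝ) ^ j * |x b - y b| ≤ 2 ^ j * ρ j := by
        rw [h3]
        nth_rw 1 [← abs_of_pos (show (0 : ℝ) < 2 ^ j by positivity)]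
        rw [← abs_mul]
        have : (2 : ℝ) ^ j * (x b - y b) =
            (2 ^ j * x b - ik.2 b) - (2 ^ j * y b - ik.2 b) := by ring
        rw [this]
        exact (abs_sub _ _).trans (by linarith)
      exact le_of_mul_le_mul_left h4 (by positivity)
    · simp
  refine dimH_le_of_frequently_mem V (r := fun j => ENNReal.ofReal (ρ j)) ?_ ?_ hV ?_ ?_
  · intro m n hmn
    exact ENNReal.ofReal_le_ofReal (mul_le_mul_of_nonneg_left
      (pow_le_pow_of_le_one (by positivity) hρ1.le hmn) zero_le_two)
  · rw [← ENNReal.ofReal_zero]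
    refine ENNReal.tendsto_ofReal ?_
    simpa using (tendsto_pow_atTop_nhds_zero_of_lt_one (by positivity) hρ1).const_mul 2
  · rw [ENNReal.tsum_prod (f := fun j ik => Metric.ediam (V j ik) ^ t)]
    have hterm : ∀ j ik, Metric.ediam (V j ik) ^ t ≤
        ENNReal.ofReal (B ^ P * 2 ^ t * 2 ^ ((-γ' * P + (ε - 1) * t) * (j : ℝ))) *
          ENNReal.ofReal (‖c ik.1 j ik.2‖ ^ P) := by
      intro j ik
      by_cases hj : (2 : ℝ) ^ (γ' * (j : ℝ)) ≤ B * ‖c ik.1 j ik.2‖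
      · refine (ENNReal.rpow_le_rpow (hV j ik) ht0.le).trans ?_
        rw [ENNReal.ofReal_rpow_of_nonneg (by positivity) ht0.le,
          ← ENNReal.ofReal_mul (by positivity)]
        apply ENNReal.ofReal_le_ofReal
        -- Chebyshev: the number of large coefficients is bounded by the sum of their normalized
        -- `P`-th powers.
        have h1 : 1 ≤ B ^ P * ‖c ik.1 j ik.2‖ ^ P * 2 ^ (-γ' * P * (j : ℝ)) := by
          have := Real.rpow_le_rpow (by positivity) hj hP.le
          rw [Real.mul_rpow hB0.le (norm_nonneg _)] at this
          calc (1 : ℝ) = ((2 : ℝ) ^ (γ' * (j : ℝ))) ^ P * 2 ^ (-γ' * P * (j : ℝ)) := by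
                rw [← Real.rpow_mul zero_le_two, ← Real.rpow_add two_pos]; ring_nf; simp
            _ ≤ _ := by gcongr
        have h2 : ρ j ^ t = 2 ^ t * 2 ^ ((ε - 1) * t * (j : ℝ)) := by
          simp only [ρ]
          rw [Real.mul_rpow zero_le_two (by positivity), ← Real.rpow_natCast,
            ← Real.rpow_mul zero_le_two, ← Real.rpow_mul zero_le_two]
          ring_nf
        calc ρ j ^ t ≤ (B ^ P * ‖c ik.1 j ik.2‖ ^ P * 2 ^ (-γ' * P * (j : ℝ))) * ρ j ^ t :=
              le_mul_of_one_le_left (by positivity) h1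
          _ = _ := by rw [h2, add_mul, Real.rpow_add two_pos]; ring
      · simp [V, if_neg hj, ht0]
    have hlevel : ∀ j : ℕ, ∑' ik, Metric.ediam (V j ik) ^ t ≤
        ENNReal.ofReal (B ^ P * 2 ^ t * E * ((2 : ℝ) ^ a) ^ j) := by
      intro j
      refine (ENNReal.tsum_le_tsum (hterm j)).trans ?_
      rw [ENNReal.tsum_mul_left]
      refine (mul_le_mul_right (hE j) _).trans ?_
      rw [← ENNReal.ofReal_mul (by positivity)]
      apply ENNReal.ofReal_le_ofReal
      apply le_of_eq
      rw [← Real.rpow_natCast, ← Real.rpow_mul zero_le_two, ha,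
        show (d - s * P - γ' * P + (ε - 1) * t) * (j : ℝ) =
          (-γ' * P + (ε - 1) * t) * (j : ℝ) + (d - s * P) * (j : ℝ) by ring,
        Real.rpow_add two_pos]
      ring
    refine ne_top_of_le_ne_top ?_ (ENNReal.tsum_le_tsum hlevel)
    have ha1 : (2 : ℝ) ^ a < 1 := Real.rpow_lt_one_of_one_lt_of_neg one_lt_two ha0
    rw [← ENNReal.ofReal_tsum_of_nonneg (fun _ => by positivity)
      ((summable_geometric_of_lt_one (by positivity) ha1).mul_left _)]
    exact ENNReal.ofReal_ne_top
  · intro x hx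
    have : (γ' : EReal) < divExponent ψ c x := by
      refine lt_of_lt_of_le (EReal.coe_lt_coe_iff.2 ?_) hx
      have : 0 < g / (4 * P) := by positivity
      rw [hγ']; linarith
    refine (frequently_near_of_lt_divExponent hψ hp hc hB hε0 this).mono ?_
    rintro j ⟨i, k, h1, h2⟩
    refine ⟨(i, k), ?_⟩
    simp only [V, if_pos h1]
    exact h2

end Exponent

/-! ### Dyadic cubes and the saturating sequence -/

/-- The positions of the dyadic cubes of scale `j` contained in the unit cube. -/
def dyadicBox (d j : ℕ) : Finset (Fin d → ℤ) := Fintype.piFinset fun _ => Finset.Ico 0 (2 ^ j)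

theorem mem_dyadicBox {j : ℕ} {k : Fin d → ℤ} :
    k ∈ dyadicBox d j ↔ ∀ a, 0 ≤ k a ∧ k a < 2 ^ j := by simp [dyadicBox]

theorem card_dyadicBox (d j : ℕ) : (dyadicBox d j).card = (2 ^ j) ^ d := by
  have : ((2 : ℤ) ^ j).toNat = 2 ^ j := by
    rw [show (2 : ℤ) ^ j = ((2 ^ j : ℕ) : ℤ) by push_cast; rfl, Int.toNat_natCast]
  simp [dyadicBox, Fintype.card_piFinset, this]

theorem irredScale_spec (j : ℕ) (k : Fin d → ℤ) :
    ∃ k' : Fin d → ℤ, ∀ a, k a * 2 ^ irredScale j k = k' a * 2 ^ j :=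
  Nat.sInf_mem (s := {J : ℕ | ∃ k' : Fin d → ℤ, ∀ a, k a * 2 ^ J = k' a * 2 ^ j})
    ⟨j, k, fun _ => rfl⟩

theorem irredScale_le_of_eq {j J : ℕ} {k k' : Fin d → ℤ} (h : ∀ a, k a * 2 ^ J = k' a * 2 ^ j) :
    irredScale j k ≤ J := Nat.sInf_le ⟨k', h⟩

theorem irredScale_le (j : ℕ) (k : Fin d → ℤ) : irredScale j k ≤ j :=
  irredScale_le_of_eq (k' := k) fun _ => rfl

/-- Such positions are the multiples by `2^{j-J}` of positions in the box of scale `J`. -/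
theorem card_filter_irredScale_le (d : ℕ) {j J : ℕ} (hJ : J ≤ j) :
    ((dyadicBox d j).filter fun ν => irredScale j ν = J).card ≤ (2 ^ J) ^ d := by
  classical
  rw [← card_dyadicBox]
  refine (Finset.card_le_card (t := (dyadicBox d J).image fun k a => k a * 2 ^ (j - J)) ?_).trans
    Finset.card_image_le
  intro ν hν
  rw [Finset.mem_filter, mem_dyadicBox] at hν
  obtain ⟨k', hk'⟩ := irredScale_spec j ν
  rw [hν.2] at hk'
  have h2 : (2 : ℤ) ^ j = 2 ^ (j - J) * 2 ^ J := by rw [← pow_add, Nat.sub_add_cancel hJ]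
  have hk : ∀ a, ν a = k' a * 2 ^ (j - J) := fun a => by
    have := hk' a
    rw [h2, ← mul_assoc] at this
    exact mul_right_cancel₀ (by positivity) this
  refine Finset.mem_image.2 ⟨k', mem_dyadicBox.2 fun a => ?_, funext fun a => (hk a).symm⟩
  have h1 := hν.1 a
  rw [hk a] at h1
  have hpos : (0 : ℤ) < 2 ^ (j - J) := by positivity
  refine ⟨nonneg_of_mul_nonneg_left h1.1 hpos, ?_⟩
  have h3 := h1.2
  rw [h2, mul_comm (2 ^ (j - J) : ℤ)] at h3
  exact lt_of_mul_lt_mul_right h3 hpos.le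

/-- Each value of `J` from 0 to `j` contributes at most 1, the weight `2^{-dJ}` balancing the count
`2^{dJ}`. -/
theorem sum_irredScale_le (d j : ℕ) :
    ∑ ν ∈ dyadicBox d j, ((1 / 2 : ℝ) ^ d) ^ irredScale j ν ≤ j + 1 := by
  rw [← Finset.sum_fiberwise_of_maps_to (t := Finset.range (j + 1)) (g := fun ν => irredScale j ν)
    (fun ν _ => Finset.mem_range.2 (Nat.lt_succ_of_le (irredScale_le j ν)))]
  calc _ ≤ ∑ J ∈ Finset.range (j + 1), (1 : ℝ) := by
        refine Finset.sum_le_sum fun J hJ => ?_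
        have hJ' : J ≤ j := Nat.lt_succ_iff.1 (Finset.mem_range.1 hJ)
        rw [Finset.sum_congr rfl (g := fun _ => ((1 / 2 : ℝ) ^ d) ^ J)
          (fun ν hν => by rw [(Finset.mem_filter.1 hν).2]), Finset.sum_const, nsmul_eq_mul]
        calc _ ≤ (((2 ^ J) ^ d : ℕ) : ℝ) * ((1 / 2 : ℝ) ^ d) ^ J := by
              gcongr
              exact card_filter_irredScale_le d hJ'
          _ = 1 := by
              push_cast
              rw [pow_right_comm (2 : ℝ), ← mul_pow, ← mul_pow]
              norm_num
    _ = j + 1 := by simp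

theorem eCoeff_pos (s : ℝ) (p : ℝ≥0∞) (j : ℕ) (k : Fin d → ℤ) : 0 < eCoeff s p j k := by
  unfold eCoeff; positivity

theorem eCoeff_mul_le (s : ℝ) (p : ℝ≥0∞) {j j' M : ℕ} (h1 : j' ≤ j) (h2 : j ≤ j' + M)
    (k : Fin d → ℤ) :
    eCoeff s p j' k * 2 ^ ((s - dimOver d p) * (j : ℝ)) ≤
      2 ^ (|s - dimOver d p| * M) * 2 ^ (-(Real.log (j' : ℝ)) ^ 2) *
        2 ^ (-(dimOver d p * (irredScale j' k : ℝ))) := by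
  have hj : (2 : ℝ) ^ ((dimOver d p - s) * (j' : ℝ)) * 2 ^ ((s - dimOver d p) * (j : ℝ)) ≤
      2 ^ (|s - dimOver d p| * M) := by
    rw [← Real.rpow_add two_pos]
    apply Real.rpow_le_rpow_of_exponent_le one_le_two
    have h3 : (0 : ℝ) ≤ (j : ℝ) - j' := sub_nonneg.2 (by exact_mod_cast h1)
    have h4 : (j : ℝ) - j' ≤ M := by rw [sub_le_iff_le_add']; exact_mod_cast h2
    calc _ = (s - dimOver d p) * ((j : ℝ) - j') := by ring
      _ ≤ |s - dimOver d p| * ((j : ℝ) - j') := by gcongr; exact le_abs_self _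
      _ ≤ _ := by gcongr
  unfold eCoeff
  calc _ = (2 : ℝ) ^ (-(Real.log (j' : ℝ)) ^ 2) * 2 ^ (-(dimOver d p * (irredScale j' k : ℝ))) *
        ((2 : ℝ) ^ ((dimOver d p - s) * (j' : ℝ)) * 2 ^ ((s - dimOver d p) * (j : ℝ))) := by ring
    _ ≤ (2 : ℝ) ^ (-(Real.log (j' : ℝ)) ^ 2) * 2 ^ (-(dimOver d p * (irredScale j' k : ℝ))) *
        2 ^ (|s - dimOver d p| * M) := by gcongr
    _ = _ := by ring

/-! ### Bounds for `fCoeff` and Besov membership of the saturating sequence. -/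

section Saturating

variable {ψ : Fin N → (Fin d → ℝ) → 𝕜} (T : DyadicCovering ψ) (s : ℝ) (p : ℝ≥0∞)

theorem DyadicCovering.scale_le_depth (l : Fin T.L) : T.scale l ≤ T.depth :=
  Finset.le_sup (f := T.scale) (Finset.mem_univ l)

theorem DyadicCovering.nonempty_fin : Nonempty (Fin T.L) := by
  obtain ⟨C, _, h⟩ := T.exists_bound
  obtain ⟨l, _⟩ := h 0 fun a => by simp
  exact ⟨l⟩

theorem DyadicCovering.depth_pos : 0 < T.depth := by
  obtain ⟨l⟩ := T.nonempty_fin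
  exact (T.scale_pos l).trans_le (T.scale_le_depth l)

theorem eCoeff_le_fCoeff {m : ℕ} (hm : 1 ≤ m) {ν : Fin d → ℤ}
    (hν : ν ∈ dyadicBox d (m * T.depth)) (l : Fin T.L) :
    eCoeff s p (m * T.depth) ν ≤
      fCoeff T s p (T.cube l (m * T.depth) ν).1 (T.cube l (m * T.depth) ν).2 := by
  have h1 := T.scale_pos l
  have h2 := T.scale_le_depth l
  refine le_csSup ?_ ⟨m, hm, ?_, ?_, ν, mem_dyadicBox.1 hν, ⟨l, rfl⟩, rfl⟩
  · refine Set.Finite.bddAbove (((Finset.range ((T.cube l (m * T.depth) ν).1 + 1)).biUnion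
      fun m' => (dyadicBox d (m' * T.depth)).image
        (eCoeff s p (m' * T.depth))).finite_toSet.subset ?_)
    rintro _ ⟨m', hm', h3, -, ν', hν', -, rfl⟩
    rw [Finset.mem_coe, Finset.mem_biUnion]
    refine ⟨m', Finset.mem_range.2 ?_, Finset.mem_image_of_mem _ (mem_dyadicBox.2 hν')⟩
    have := Nat.le_mul_of_pos_right m' T.depth_pos
    omega
  · simp only [DyadicCovering.cube]; omega
  · simp only [DyadicCovering.cube]; rw [add_mul]; omega

theorem fCoeff_nonneg (j : ℕ) (k : Fin d → ℤ) : 0 ≤ fCoeff T s p j k := by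
  refine Real.sSup_nonneg ?_
  rintro _ ⟨m, -, -, -, ν, -, -, rfl⟩
  exact (eCoeff_pos s p _ ν).le

/-- The scale of the cubes `ν` that enter the definition of `f_λ` for `λ` of scale `j`. -/
def DyadicCovering.baseScale (j : ℕ) : ℕ := (j - 1) / T.depth * T.depth

theorem DyadicCovering.baseScale_le (j : ℕ) : T.baseScale j ≤ j :=
  (Nat.div_mul_le_self _ _).trans (Nat.sub_le _ _)

theorem DyadicCovering.le_baseScale_add (j : ℕ) : j ≤ T.baseScale j + T.depth := by
  have := Nat.lt_div_mul_add T.depth_pos (a := j - 1)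
  unfold DyadicCovering.baseScale
  omega

variable {T s p} in
theorem fCoeff_le_of_forall_le {j : ℕ} {k : Fin d → ℤ} {b : ℝ} (hb : 0 ≤ b)
    (h : ∀ l, ∀ ν ∈ dyadicBox d (T.baseScale j), T.cube l (T.baseScale j) ν = (j, k) →
      eCoeff s p (T.baseScale j) ν ≤ b) : fCoeff T s p j k ≤ b := by
  refine Real.sSup_le ?_ hb
  rintro _ ⟨m, hm, h1, h2, ν, hν, ⟨l, hl⟩, rfl⟩
  -- Blocks are `m M < j ≤ (m + 1) M`, closed on the right, hence the division of `j - 1`.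
  have hmj : (j - 1) / T.depth = m := by
    refine Nat.div_eq_of_lt_le ?_ ?_
    · omega
    · have := T.depth_pos
      have : 0 < (m + 1) * T.depth := by positivity
      omega
  have hbase : T.baseScale j = m * T.depth := by rw [DyadicCovering.baseScale, hmj]
  rw [hbase] at h
  exact h l ν (mem_dyadicBox.2 hν) hl

/-- The supremum defining `f_λ` is replaced by a sum over the pairs `(l, ν)` with `μ^l(ν) = λ`.
After exchanging sums, each pair meets one position for each of the `N` wavelets, and
`sum_irredScale_le` applies. -/
theorem sum_fCoeff_rpow_le (hp : 0 < p) (hp' : p ≠ ∞) (j : ℕ)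
    (t : Finset (Fin N × (Fin d → ℤ))) :
    ∑ ik ∈ t, (fCoeff T s p j ik.2 * 2 ^ ((s - dimOver d p) * (j : ℝ))) ^ p.toReal ≤
      N * T.L * (2 ^ (|s - dimOver d p| * T.depth) *
        2 ^ (-(Real.log (T.baseScale j : ℝ)) ^ 2)) ^ p.toReal * (T.baseScale j + 1) := by
  classical
  have hP : 0 < p.toReal := ENNReal.toReal_pos hp.ne' hp'
  set P := p.toReal
  set j' := T.baseScale j with hj'
  set w : ℝ := 2 ^ ((s - dimOver d p) * (j : ℝ)) with hw
  have hw0 : 0 < w := by positivity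
  set K : ℝ := 2 ^ (|s - dimOver d p| * T.depth) * 2 ^ (-(Real.log (j' : ℝ)) ^ 2) with hK
  have hK0 : 0 < K := by positivity
  let G : Fin T.L → (Fin d → ℤ) → (Fin d → ℤ) → ℝ := fun l ν k =>
    if T.cube l j' ν = (j, k) then (eCoeff s p j' ν * w) ^ P else 0
  have hG0 : ∀ l ν k, 0 ≤ G l ν k := by
    intro l ν k
    simp only [G]
    have := (eCoeff_pos s p j' ν).le
    split_ifs <;> positivity
  have h1 : ∀ k, (fCoeff T s p j k * w) ^ P ≤ ∑ l, ∑ ν ∈ dyadicBox d j', G l ν k := by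
    intro k
    have hS0 : 0 ≤ ∑ l, ∑ ν ∈ dyadicBox d j', G l ν k :=
      Finset.sum_nonneg fun l _ => Finset.sum_nonneg fun ν _ => hG0 l ν k
    rw [← Real.le_rpow_inv_iff_of_pos (mul_nonneg (fCoeff_nonneg T s p j k) hw0.le) hS0 hP,
      ← le_div_iff₀ hw0]
    refine fCoeff_le_of_forall_le (by positivity) fun l ν hν hl => ?_
    have he := (eCoeff_pos s p j' ν).le
    rw [le_div_iff₀ hw0, Real.le_rpow_inv_iff_of_pos (by positivity) hS0 hP]
    calc (eCoeff s p j' ν * w) ^ P = G l ν k := by simp only [G]; rw [if_pos hl]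
      _ ≤ ∑ ν ∈ dyadicBox d j', G l ν k :=
          Finset.single_le_sum (f := fun ν => G l ν k) (fun ν _ => hG0 l ν k) hν
      _ ≤ _ := Finset.single_le_sum (f := fun l => ∑ ν ∈ dyadicBox d j', G l ν k)
          (fun l _ => Finset.sum_nonneg fun ν _ => hG0 l ν k) (Finset.mem_univ l)
  have h2 : ∀ ν : Fin d → ℤ, (eCoeff s p j' ν * w) ^ P ≤ K ^ P * ((1 / 2 : ℝ) ^ d) ^ irredScale j' ν := by
    intro ν
    have he := (eCoeff_pos s p j' ν).le
    refine (Real.rpow_le_rpow (by positivity) (eCoeff_mul_le s p (T.baseScale_le j)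
      (T.le_baseScale_add j) ν) hP.le).trans_eq ?_
    rw [Real.mul_rpow (by positivity) (by positivity)]
    congr 1
    rw [← Real.rpow_mul zero_le_two, show -(dimOver d p * (irredScale j' ν : ℝ)) * P =
      -(((d * irredScale j' ν : ℕ)) : ℝ) by
        push_cast; rw [← toReal_mul_dimOver hp hp' (d := d)]; ring,
      Real.rpow_neg zero_le_two, Real.rpow_natCast, ← pow_mul, one_div, inv_pow]
  have h3 : ∀ l ν, ∑ ik ∈ t, G l ν ik.2 ≤ N * (K ^ P * ((1 / 2 : ℝ) ^ d) ^ irredScale j' ν) := by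
    intro l ν
    calc ∑ ik ∈ t, G l ν ik.2 ≤ ∑ ik ∈ (Finset.univ : Finset (Fin N)) ×ˢ t.image Prod.snd,
          G l ν ik.2 :=
          Finset.sum_le_sum_of_subset_of_nonneg (fun ik hik => Finset.mem_product.2
            ⟨Finset.mem_univ _, Finset.mem_image_of_mem _ hik⟩) fun ik _ _ => hG0 l ν ik.2
      _ = ∑ i : Fin N, ∑ k ∈ t.image Prod.snd, G l ν k := Finset.sum_product _ _ _
      _ ≤ ∑ i : Fin N, (K ^ P * ((1 / 2 : ℝ) ^ d) ^ irredScale j' ν) := by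
          refine Finset.sum_le_sum fun i _ => le_trans ?_ (h2 ν)
          have he := (eCoeff_pos s p j' ν).le
          have hle : ∀ k, G l ν k ≤ if (T.cube l j' ν).2 = k then
              (eCoeff s p j' ν * w) ^ P else 0 := by
            intro k
            simp only [G]
            split_ifs with h h' h'
            · exact le_rfl
            · exact absurd (by rw [h]) h'
            · positivity
            · exact le_rfl
          refine (Finset.sum_le_sum fun k _ => hle k).trans ?_
          rw [Finset.sum_ite_eq]
          split_ifs
          · exact le_rfl
          · positivity
      _ = _ := by simp
  calc _ ≤ ∑ ik ∈ t, ∑ l, ∑ ν ∈ dyadicBox d j', G l ν ik.2 := Finset.sum_le_sum fun ik _ => h1 ik.2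
    _ = ∑ l, ∑ ν ∈ dyadicBox d j', ∑ ik ∈ t, G l ν ik.2 := by
        rw [Finset.sum_comm]
        exact Finset.sum_congr rfl fun l _ => Finset.sum_comm
    _ ≤ ∑ l : Fin T.L, ∑ ν ∈ dyadicBox d j', N * (K ^ P * ((1 / 2 : ℝ) ^ d) ^ irredScale j' ν) :=
        Finset.sum_le_sum fun l _ => Finset.sum_le_sum fun ν _ => h3 l ν
    _ = N * T.L * K ^ P * ∑ ν ∈ dyadicBox d j', ((1 / 2 : ℝ) ^ d) ^ irredScale j' ν := by
        rw [Finset.sum_const, Finset.card_univ, Fintype.card_fin, nsmul_eq_mul, ← Finset.mul_sum,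
          ← Finset.mul_sum]
        ring
    _ ≤ _ := by
        gcongr
        exact sum_irredScale_le d j'

/-- The factor `2^{-(log j)^2}` beats every power of `j`, by completing the square in `log n`. It
absorbs the loss `j + 1` of `sum_irredScale_le` and ensures membership in `ℓ^q` for every `q`. -/
theorem exists_two_rpow_neg_log_sq_le (R : ℝ) : ∃ C : ℝ, 0 < C ∧ ∀ n : ℕ,
    (2 : ℝ) ^ (-(Real.log (n : ℝ)) ^ 2) ≤ C * ((n : ℝ) + 1) ^ (-R) := by
  have hl : 0 < Real.log 2 := Real.log_pos one_lt_two
  refine ⟨Real.exp (R ^ 2 / (4 * Real.log 2)) * 2 ^ |R|, by positivity, fun n => ?_⟩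
  have hn1 : (1 : ℝ) ≤ (n : ℝ) + 1 := by simp
  rcases Nat.eq_zero_or_pos n with rfl | hn
  · have h1 : (1 : ℝ) ≤ Real.exp (R ^ 2 / (4 * Real.log 2)) := Real.one_le_exp (by positivity)
    have h2 : (1 : ℝ) ≤ 2 ^ |R| := Real.one_le_rpow one_le_two (abs_nonneg _)
    simpa using one_le_mul_of_one_le_of_one_le h1 h2
  have hn0 : (1 : ℝ) ≤ n := by exact_mod_cast hn
  set y := Real.log n with hy
  have h1 : (2 : ℝ) ^ (-y ^ 2) ≤ Real.exp (R ^ 2 / (4 * Real.log 2)) * (n : ℝ) ^ (-R) := by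
    rw [Real.rpow_def_of_pos two_pos, Real.rpow_def_of_pos (by linarith), ← Real.exp_add, ← hy]
    apply Real.exp_le_exp.2
    have : R ^ 2 / (4 * Real.log 2) + y * -R + Real.log 2 * y ^ 2 =
        Real.log 2 * (y - R / (2 * Real.log 2)) ^ 2 := by field_simp; ring
    have h2 : 0 ≤ Real.log 2 * (y - R / (2 * Real.log 2)) ^ 2 := by positivity
    linarith
  have h2 : (n : ℝ) ^ (-R) ≤ 2 ^ |R| * ((n : ℝ) + 1) ^ (-R) := by
    have h3 : (((n : ℝ) + 1) / n) ^ R ≤ 2 ^ |R| := by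
      have h4 : 1 ≤ ((n : ℝ) + 1) / n := by rw [le_div_iff₀ (by linarith)]; linarith
      have h5 : ((n : ℝ) + 1) / n ≤ 2 := by rw [div_le_iff₀ (by linarith)]; linarith
      calc _ ≤ (((n : ℝ) + 1) / n) ^ |R| :=
            Real.rpow_le_rpow_of_exponent_le h4 (le_abs_self R)
        _ ≤ _ := by gcongr
    rw [Real.div_rpow (by linarith) (by linarith), div_le_iff₀ (by positivity)] at h3
    rw [Real.rpow_neg (by linarith), Real.rpow_neg (by linarith), ← div_eq_mul_inv,
      inv_le_iff_one_le_mul₀ (by positivity), div_mul_eq_mul_div, le_div_iff₀ (by positivity),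
      one_mul]
    exact h3
  calc _ ≤ _ := h1
    _ ≤ Real.exp (R ^ 2 / (4 * Real.log 2)) * (2 ^ |R| * ((n : ℝ) + 1) ^ (-R)) := by gcongr
    _ = _ := by ring

theorem exists_memℓp_rpow_neg {q : ℝ≥0∞} (hq : 0 < q) :
    ∃ R : ℝ, 0 ≤ R ∧ Memℓp (fun j : ℕ => ((j : ℝ) + 1) ^ (-R)) q := by
  rcases eq_or_ne q ∞ with rfl | hq'
  · refine ⟨0, le_rfl, memℓp_infty ⟨1, ?_⟩⟩
    rintro _ ⟨j, rfl⟩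
    simp
  · have hQ : 0 < q.toReal := ENNReal.toReal_pos hq.ne' hq'
    refine ⟨2 / q.toReal, by positivity, memℓp_gen ?_⟩
    have h := (summable_nat_add_iff 1).2 (Real.summable_nat_rpow.2 (show (-2 : ℝ) < -1 by norm_num))
    refine h.congr fun j => ?_
    rw [Real.norm_eq_abs, abs_of_nonneg (by positivity), ← Real.rpow_mul (by positivity)]
    push_cast
    congr 1
    field_simp

variable {T s p} in
/-- The saturating sequence is in all the spaces `b^{s,q}_p`. -/
theorem inBesov_saturating {q : ℝ≥0∞} (hp : 0 < p) (hq : 0 < q)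
    {ξ : Fin N × ℕ × (Fin d → ℤ) → ℝ} (hξ : ∀ a, |ξ a| ≤ 1) :
    InBesov s p q (saturating T s p ξ) := by
  have hle : ∀ j ik, ‖besovLevel s p (saturating T s p ξ) j ik‖ ≤
      fCoeff T s p j ik.2 * 2 ^ ((s - dimOver d p) * (j : ℝ)) := by
    intro j ik
    have := fCoeff_nonneg T s p j ik.2
    rw [besovLevel, Real.norm_eq_abs, abs_of_nonneg (by positivity), saturating, RCLike.norm_ofReal,
      abs_mul, abs_of_nonneg this]
    gcongr
    exact mul_le_of_le_one_left this (hξ _)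
  obtain ⟨K, κ, hK0, hK⟩ : ∃ K κ : ℝ, 0 ≤ K ∧ ∀ j,
      ∃ h : Memℓp (besovLevel s p (saturating T s p ξ) j) p,
        ‖(⟨_, h⟩ : lp (fun _ : Fin N × (Fin d → ℤ) => ℝ) p)‖ ≤
          K * (2 ^ (-(Real.log (T.baseScale j : ℝ)) ^ 2) * ((T.baseScale j : ℝ) + 1) ^ κ) := by
    rcases eq_or_ne p ∞ with rfl | hp'
    · refine ⟨2 ^ (|s - dimOver d ∞| * T.depth), 0, by positivity, fun j => ?_⟩
      have hb : ∀ ik, ‖besovLevel s ∞ (saturating T s ∞ ξ) j ik‖ ≤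
          2 ^ (|s - dimOver d ∞| * T.depth) * (2 ^ (-(Real.log (T.baseScale j : ℝ)) ^ 2) *
            ((T.baseScale j : ℝ) + 1) ^ (0 : ℝ)) := by
        intro ik
        refine (hle j ik).trans ?_
        rw [← le_div_iff₀ (by positivity)]
        refine fCoeff_le_of_forall_le (by positivity) fun l ν hν hl => ?_
        rw [le_div_iff₀ (by positivity)]
        refine (eCoeff_mul_le s ∞ (T.baseScale_le j) (T.le_baseScale_add j) ν).trans_eq ?_
        simp [dimOver_top]
      refine ⟨memℓp_infty ⟨_, by rintro _ ⟨ik, rfl⟩; exact hb ik⟩, ?_⟩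
      exact lp.norm_le_of_forall_le (by positivity) hb
    · have hP : 0 < p.toReal := ENNReal.toReal_pos hp.ne' hp'
      set P := p.toReal
      refine ⟨(N * T.L : ℝ) ^ P⁻¹ * 2 ^ (|s - dimOver d p| * T.depth), P⁻¹, by positivity,
        fun j => ?_⟩
      have hb : ∀ t : Finset (Fin N × (Fin d → ℤ)),
          ∑ ik ∈ t, ‖besovLevel s p (saturating T s p ξ) j ik‖ ^ P ≤
          ((N * T.L : ℝ) ^ P⁻¹ * 2 ^ (|s - dimOver d p| * T.depth) *
            (2 ^ (-(Real.log (T.baseScale j : ℝ)) ^ 2) *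
            ((T.baseScale j : ℝ) + 1) ^ P⁻¹)) ^ P := by
        intro t
        refine ((Finset.sum_le_sum fun ik _ => Real.rpow_le_rpow (norm_nonneg _) (hle j ik)
          hP.le).trans (sum_fCoeff_rpow_le T s p hp hp' j t)).trans_eq ?_
        have hA0 : (0 : ℝ) ≤ N * T.L := by positivity
        generalize (N * T.L : ℝ) = A at hA0 ⊢
        rw [Real.mul_rpow (by positivity) (by positivity),
          Real.mul_rpow (by positivity) (by positivity),
          Real.mul_rpow (by positivity) (by positivity),
          Real.mul_rpow (by positivity) (by positivity),
          Real.rpow_inv_rpow (by positivity) hP.ne', Real.rpow_inv_rpow (by positivity) hP.ne']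
        ring
      exact ⟨memℓp_gen' hb, lp.norm_le_of_forall_sum_le hP (by positivity) hb⟩
  obtain ⟨R, hR0, hR⟩ := exists_memℓp_rpow_neg hq
  -- The power `κ` cancels the polynomial growth of the level norms, and `R` gives the decay
  -- required by `ℓ^q`.
  obtain ⟨C, hC0, hC⟩ := exists_two_rpow_neg_log_sq_le (κ + R)
  refine ⟨fun j => (hK j).1, (hR.const_mul (K * C * (T.depth + 1) ^ R)).mono fun j => ?_⟩
  refine (abs_of_nonneg (lp.norm_nonneg' _)).trans_le ((hK j).2.trans ?_)
  set n := T.baseScale j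
  have h1 : (2 : ℝ) ^ (-(Real.log (n : ℝ)) ^ 2) * ((n : ℝ) + 1) ^ κ ≤ C * ((n : ℝ) + 1) ^ (-R) := by
    calc _ ≤ C * ((n : ℝ) + 1) ^ (-(κ + R)) * ((n : ℝ) + 1) ^ κ := by
          gcongr; exact hC n
      _ = _ := by rw [mul_assoc, ← Real.rpow_add (by positivity)]; ring_nf
  have h2 : ((n : ℝ) + 1) ^ (-R) ≤ (T.depth + 1) ^ R * ((j : ℝ) + 1) ^ (-R) := by
    have h3 : (j : ℝ) + 1 ≤ (T.depth + 1) * ((n : ℝ) + 1) := by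
      have : (j : ℝ) ≤ n + T.depth := by exact_mod_cast T.le_baseScale_add j
      nlinarith [mul_nonneg (Nat.cast_nonneg (α := ℝ) T.depth) (Nat.cast_nonneg (α := ℝ) n)]
    have h4 := Real.rpow_le_rpow (by positivity) h3 hR0
    rw [Real.mul_rpow (by positivity) (by positivity)] at h4
    rw [Real.rpow_neg (by positivity), Real.rpow_neg (by positivity), ← div_eq_mul_inv,
      inv_le_iff_one_le_mul₀ (by positivity), div_mul_eq_mul_div, le_div_iff₀ (by positivity),
      one_mul]
    exact h4
  calc _ ≤ K * (C * ((T.depth + 1) ^ R * ((j : ℝ) + 1) ^ (-R))) := by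
        exact mul_le_mul_of_nonneg_left (h1.trans (mul_le_mul_of_nonneg_left h2 hC0.le)) hK0
    _ = _ := by ring

end Saturating

/-! ### Lower bounds for the randomized coefficients -/

/-- The position of the dyadic cube of scale `j` that contains `x`. -/
def cubeAt (j : ℕ) (x : Fin d → ℝ) : Fin d → ℤ := fun a => ⌊(2 : ℝ) ^ j * x a⌋

theorem cubeAt_mem_dyadicBox {x : Fin d → ℝ} (hx : x ∈ unitCube d) (j : ℕ) :
    cubeAt j x ∈ dyadicBox d j := by
  refine mem_dyadicBox.2 fun a => ⟨?_, ?_⟩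
  · have := (hx a).1
    exact Int.floor_nonneg.2 (by positivity)
  · rw [cubeAt, Int.floor_lt]
    push_cast
    exact mul_lt_of_lt_one_right (by positivity) (hx a).2

theorem cubeAt_eq_div (j e : ℕ) (x : Fin d → ℝ) :
    cubeAt j x = fun a => cubeAt (j + e) x a / 2 ^ e := by
  funext a
  have h := Int.floor_div_natCast ((2 : ℝ) ^ (j + e) * x a) (2 ^ e)
  push_cast at h
  rw [cubeAt, cubeAt, ← h]
  congr 1
  rw [pow_add]
  field_simp

section SmallBall

variable {Ω : Type*} [MeasurableSpace Ω] {P : Measure Ω}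

theorem measure_preimage_Ioo_le {X : Ω → ℝ} (hX : pdf.IsUniform X (Set.Icc (-1 : ℝ) 1) P)
    (b : ℝ) {r : ℝ} : P (X ⁻¹' Ioo (b - r) (b + r)) ≤ ENNReal.ofReal r := by
  have hvol : (volume (Set.Icc (-1 : ℝ) 1)) = 2 := by
    rw [Real.volume_Icc]; norm_num
  rw [hX.measure_preimage (by rw [hvol]; norm_num) (by rw [hvol]; norm_num) measurableSet_Ioo, hvol]
  refine ENNReal.div_le_of_le_mul ((measure_mono inter_subset_right).trans_eq ?_)
  rw [Real.volume_Ioo, show b + r - (b - r) = r * 2 by ring, ENNReal.ofReal_mul' zero_le_two]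
  norm_num

/-- The random part is real, so a complex perturbation only recentres the interval, by its real
part. -/
theorem mem_Ioo_of_norm_lt {f r y : ℝ} (hf : 0 < f) {z : 𝕜}
    (h : ‖((y * f : ℝ) : 𝕜) + z‖ < r * f) :
    y ∈ Ioo (-(RCLike.re z / f) - r) (-(RCLike.re z / f) + r) := by
  have h1 := (RCLike.abs_re_le_norm (((y * f : ℝ) : 𝕜) + z)).trans_lt h
  rw [map_add, RCLike.ofReal_re, abs_lt] at h1
  have h2 : RCLike.re z / f * f = RCLike.re z := div_mul_cancel₀ _ hf.ne'
  constructor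
  · refine lt_of_mul_lt_mul_right (a := f) ?_ hf.le
    linarith [h1.1]
  · refine lt_of_mul_lt_mul_right (a := f) ?_ hf.le
    linarith [h1.2]

/-- Independent uniform variables, shifted, are all small with small probability. -/
theorem measure_iInter_preimage_Ioo_le {ι : Type*} {ξ : ι → Ω → ℝ}
    (hξ_unif : ∀ a, pdf.IsUniform (ξ a) (Set.Icc (-1 : ℝ) 1) P) (hξ_indep : iIndepFun ξ P)
    {t : ℕ} {g : Fin t → ι} (hg : Function.Injective g) (b : ι → ℝ) (r : ℝ) :
    P (⋂ i, ξ (g i) ⁻¹' Ioo (b (g i) - r) (b (g i) + r)) ≤ ENNReal.ofReal r ^ t := by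
  have h := (hξ_indep.precomp hg).measure_inter_preimage_eq_mul Finset.univ
    (sets := fun i => Ioo (b (g i) - r) (b (g i) + r)) (fun _ _ => measurableSet_Ioo)
  simp only [Finset.mem_univ, iInter_true] at h
  rw [h]
  refine (Finset.prod_le_prod' fun i _ => measure_preimage_Ioo_le (hξ_unif (g i)) _).trans_eq ?_
  simp

variable {ψ : Fin N → (Fin d → ℝ) → 𝕜} (T : DyadicCovering ψ) (s : ℝ) (p : ℝ≥0∞)

/-- The event that the family `c` is small, at some cube of the dyadic covering, at all the scales
`m M`, `n ≤ m < n + t`, near some point of the unit cube. -/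
def smallSet (r : ℝ) (n t : ℕ) (c : Ω → Coeffs 𝕜 d N) : Set Ω :=
  {ω | ∃ x ∈ unitCube d, ∀ m, n ≤ m → m < n + t → ∃ l,
    ‖c ω (T.idx l) (T.cube l (m * T.depth) (cubeAt (m * T.depth) x)).1
      (T.cube l (m * T.depth) (cubeAt (m * T.depth) x)).2‖ <
      r * fCoeff T s p (T.cube l (m * T.depth) (cubeAt (m * T.depth) x)).1
        (T.cube l (m * T.depth) (cubeAt (m * T.depth) x)).2}

/-- A union bound: the cube of scale `(n + t) M` around `x` determines all its ancestors, so the bad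
event depends on `x` only through this cube and on a choice `σ` of one `l` per block. -/
theorem measure_smallSet_le [IsProbabilityMeasure P] {ξ : Fin N × ℕ × (Fin d → ℤ) → Ω → ℝ}
    (hξ_unif : ∀ a, pdf.IsUniform (ξ a) (Set.Icc (-1 : ℝ) 1) P) (hξ_indep : iIndepFun ξ P)
    (D : Coeffs 𝕜 d N) (r : ℝ) {n : ℕ} (hn : 1 ≤ n) (t : ℕ) :
    P (smallSet T s p r n t fun ω => saturating T s p (fun a => ξ a ω) + D) ≤
      (((2 ^ ((n + t) * T.depth)) ^ d : ℕ) : ℝ≥0∞) * ((T.L ^ t : ℕ) : ℝ≥0∞) *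
        ENNReal.ofReal r ^ t := by
  classical
  set M := T.depth with hM
  let anc : (Fin d → ℤ) → Fin t → Fin d → ℤ := fun ν i a => ν a / 2 ^ ((t - i) * M)
  let g : (Fin d → ℤ) → (Fin t → Fin T.L) → Fin t → Fin N × ℕ × (Fin d → ℤ) := fun ν σ i =>
    (T.idx (σ i), T.cube (σ i) ((n + i) * M) (anc ν i))
  -- The cubes of different blocks have scales in the disjoint intervals `((n+i)M, (n+i+1)M]`, so
  -- the `t` variables are distinct and independence applies.
  have hg : ∀ ν σ, Function.Injective (g ν σ) := by
    intro ν σ i i' hii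
    simp only [g, DyadicCovering.cube, Prod.mk.injEq] at hii
    have h1 := hii.2.1
    have h2 := T.scale_pos (σ i)
    have h3 := T.scale_le_depth (σ i)
    have h2' := T.scale_pos (σ i')
    have h3' := T.scale_le_depth (σ i')
    rw [← hM] at h3 h3'
    rcases lt_trichotomy (i : ℕ) i' with h | h | h
    · have h4 : (n + (i : ℕ) + 1) * M ≤ (n + i') * M := Nat.mul_le_mul_right _ (by omega)
      rw [add_mul _ 1] at h4
      omega
    · exact Fin.ext h
    · have h4 : (n + (i' : ℕ) + 1) * M ≤ (n + i) * M := Nat.mul_le_mul_right _ (by omega)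
      rw [add_mul _ 1] at h4
      omega
  let b : Fin N × ℕ × (Fin d → ℤ) → ℝ := fun z =>
    -(RCLike.re (D z.1 z.2.1 z.2.2) / fCoeff T s p z.2.1 z.2.2)
  have hsub : smallSet T s p r n t (fun ω => saturating T s p (fun a => ξ a ω) + D) ⊆
      ⋃ z ∈ dyadicBox d ((n + t) * M) ×ˢ (Finset.univ : Finset (Fin t → Fin T.L)),
        ⋂ i, ξ (g z.1 z.2 i) ⁻¹' Ioo (b (g z.1 z.2 i) - r) (b (g z.1 z.2 i) + r) := by
    rintro ω ⟨x, hx, h⟩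
    have h' : ∀ i : Fin t, ∃ l, _ := fun i => h (n + i) (by omega) (by omega)
    choose σ hσ using h'
    refine mem_iUnion₂.2 ⟨(cubeAt ((n + t) * M) x, σ), Finset.mem_product.2
      ⟨cubeAt_mem_dyadicBox hx _, Finset.mem_univ _⟩, mem_iInter.2 fun i => ?_⟩
    have hanc : anc (cubeAt ((n + t) * M) x) i = cubeAt ((n + i) * M) x := by
      rw [cubeAt_eq_div ((n + i) * M) ((t - i) * M) x, ← add_mul,
        show n + (i : ℕ) + (t - i) = n + t by omega]
    have hlt := hσ i
    rw [← hM, ← hanc] at hlt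
    refine mem_Ioo_of_norm_lt (f := fCoeff T s p _ _) ?_ hlt
    change 0 < fCoeff T s p (T.cube (σ i) ((n + i) * M) (anc _ i)).1
      (T.cube (σ i) ((n + i) * M) (anc _ i)).2
    rw [hanc]
    exact (eCoeff_pos s p _ _).trans_le (eCoeff_le_fCoeff T s p (by omega)
      (cubeAt_mem_dyadicBox hx _) _)
  refine (measure_mono hsub).trans ((measure_biUnion_finset_le _ _).trans ?_)
  refine (Finset.sum_le_sum fun z _ =>
    measure_iInter_preimage_Ioo_le hξ_unif hξ_indep (hg z.1 z.2) b r).trans_eq ?_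
  rw [Finset.sum_const, nsmul_eq_mul, Finset.card_product, card_dyadicBox, Finset.card_univ,
    Fintype.card_fun, Fintype.card_fin, Fintype.card_fin, Nat.cast_mul]

/-- Almost surely, near every point there are large coefficients at scales in short intervals. -/
theorem ae_eventually_exists_large [IsProbabilityMeasure P]
    {ξ : Fin N × ℕ × (Fin d → ℤ) → Ω → ℝ}
    (hξ_unif : ∀ a, pdf.IsUniform (ξ a) (Set.Icc (-1 : ℝ) 1) P) (hξ_indep : iIndepFun ξ P)
    (D : Coeffs 𝕜 d N) : ∃ κ : ℕ, ∀ᵐ ω ∂P, ∀ᶠ n : ℕ in atTop, ∀ x ∈ unitCube d,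
      ∃ m, n ≤ m ∧ m < n + (Nat.sqrt n + 1) ∧ ∀ l,
        (T.L : ℝ)⁻¹ * (1 / 2) ^ (κ * (Nat.sqrt n + 1)) *
          eCoeff s p (m * T.depth) (cubeAt (m * T.depth) x) ≤
        ‖(saturating T s p (fun a => ξ a ω) + D) (T.idx l)
          (T.cube l (m * T.depth) (cubeAt (m * T.depth) x)).1
          (T.cube l (m * T.depth) (cubeAt (m * T.depth) x)).2‖ := by
  -- With `t = √n + 1` one has `n, t ≤ t²`, so `κ t²` exceeds `(n + t) M d + n`: the smallness of
  -- `r^t` beats the number of cubes with `2^{-n}` to spare. The factor `L⁻¹` in `r` cancels the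
  -- `L^t` choices.
  set κ := 2 * T.depth * d + 1 with hκ
  refine ⟨κ, ?_⟩
  have hL : 0 < T.L := Fin.pos_iff_nonempty.2 T.nonempty_fin
  let r : ℕ → ℝ := fun n => (T.L : ℝ)⁻¹ * (1 / 2) ^ (κ * (Nat.sqrt n + 1))
  have hbound : ∀ n, P (smallSet T s p (r n) n (Nat.sqrt n + 1)
      fun ω => saturating T s p (fun a => ξ a ω) + D) ≤ ENNReal.ofReal ((1 / 2) ^ n) := by
    intro n
    rcases Nat.eq_zero_or_pos n with rfl | hn
    · simpa using prob_le_one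
    refine (measure_smallSet_le T s p hξ_unif hξ_indep D (r n) hn _).trans ?_
    set t := Nat.sqrt n + 1 with ht
    have hr : 0 ≤ r n := by positivity
    rw [← ENNReal.ofReal_pow hr, ← ENNReal.ofReal_natCast, ← ENNReal.ofReal_natCast,
      ← ENNReal.ofReal_mul (by positivity), ← ENNReal.ofReal_mul (by positivity)]
    apply ENNReal.ofReal_le_ofReal
    have h1 : n ≤ t * t := (Nat.lt_succ_sqrt n).le
    have h2 : t ≤ t * t := Nat.le_mul_self t
    have h3 : (n + t) * T.depth * d + n ≤ κ * t * t := by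
      calc (n + t) * T.depth * d + n ≤ (t * t + t * t) * T.depth * d + t * t := by gcongr
        _ = κ * t * t := by rw [hκ]; ring
    have hL' : (T.L : ℝ) ≠ 0 := by exact_mod_cast hL.ne'
    push_cast
    calc _ = (2 : ℝ) ^ ((n + t) * T.depth * d) * (1 / 2) ^ (κ * t * t) *
          ((T.L : ℝ) ^ t * ((T.L : ℝ)⁻¹) ^ t) := by
          simp only [r, mul_pow, ← ht, ← pow_mul]; ring
      _ = (2 : ℝ) ^ ((n + t) * T.depth * d) * (1 / 2) ^ (κ * t * t) := by
          rw [← mul_pow, mul_inv_cancel₀ hL', one_pow, mul_one]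
      _ ≤ (2 : ℝ) ^ ((n + t) * T.depth * d) * (1 / 2) ^ ((n + t) * T.depth * d + n) :=
          mul_le_mul_of_nonneg_left (pow_le_pow_of_le_one (by norm_num) (by norm_num) h3)
            (by positivity)
      _ = (1 / 2) ^ n := by rw [pow_add, ← mul_assoc, ← mul_pow]; norm_num
  have hsum : ∑' n, P (smallSet T s p (r n) n (Nat.sqrt n + 1)
      fun ω => saturating T s p (fun a => ξ a ω) + D) ≠ ∞ := by
    refine ne_top_of_le_ne_top ?_ (ENNReal.tsum_le_tsum hbound)
    rw [← ENNReal.ofReal_tsum_of_nonneg (fun _ => by positivity) summable_geometric_two]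
    exact ENNReal.ofReal_ne_top
  filter_upwards [ae_eventually_notMem hsum] with ω hω
  filter_upwards [hω, eventually_ge_atTop 1] with n hn hn1 x hx
  simp only [smallSet, mem_ofPred_eq, not_exists, not_and, not_forall, not_lt] at hn
  obtain ⟨m, hm1, hm2, hm⟩ := hn x hx
  refine ⟨m, hm1, hm2, fun l => le_trans ?_ (hm l)⟩
  exact mul_le_mul_of_nonneg_left (eCoeff_le_fCoeff T s p (hn1.trans hm1)
    (cubeAt_mem_dyadicBox hx _) l) (by positivity)

end SmallBall

/-! ### Lower bounds for the divergence exponent -/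

theorem nat_sqrt_le_mul_add {η : ℝ} (hη : 0 < η) (n : ℕ) :
    (Nat.sqrt n : ℝ) ≤ η * n + 1 / η := by
  have h1 : ((Nat.sqrt n : ℝ)) * Nat.sqrt n ≤ n := by exact_mod_cast Nat.sqrt_le n
  generalize (Nat.sqrt n : ℝ) = t at h1 ⊢
  have h2 : t ≤ η * (t * t) + 1 / η := by
    have h3 : η * (t * t) + 1 / η - t = η * (t - 1 / (2 * η)) ^ 2 + 3 / (4 * η) := by
      field_simp; ring
    have h4 : 0 ≤ η * (t - 1 / (2 * η)) ^ 2 + 3 / (4 * η) := by positivity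
    linarith
  have := mul_le_mul_of_nonneg_left h1 hη.le
  linarith

theorem eventually_mul_two_rpow_le_sub {γ' γ : ℝ} (h : γ' < γ) (K : ℝ) (κ : ℕ) :
    ∀ᶠ y : ℕ in atTop, K * (2 : ℝ) ^ (γ' * (y : ℝ)) ≤
      2 ^ (γ * (y : ℝ) - κ * (Nat.sqrt y + 1) - Real.log y ^ 2) := by
  set g := (γ - γ') / 4 with hg
  have hg0 : 0 < g := by rw [hg]; linarith
  set η := g / (κ + 1) with hη
  have hη0 : 0 < η := by positivity
  have hlog : ∀ᶠ y : ℕ in atTop, Real.log y ^ 2 ≤ g * y := by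
    have h1 := (Real.isLittleO_pow_log_id_atTop (n := 2)).bound hg0
    filter_upwards [tendsto_natCast_atTop_atTop.eventually h1] with y hy
    simpa [abs_of_nonneg] using hy
  filter_upwards [hlog, eventually_mul_two_rpow_lt (show γ' < γ - 3 * g by linarith) K,
    tendsto_natCast_atTop_atTop.eventually (eventually_ge_atTop (κ * (1 / η + 1) / g))]
    with y h1 h2 h3
  refine h2.le.trans (Real.rpow_le_rpow_of_exponent_le one_le_two ?_)
  have h4 := mul_le_mul_of_nonneg_left (nat_sqrt_le_mul_add hη0 y) (Nat.cast_nonneg κ)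
  rw [div_le_iff₀ hg0] at h3
  have h5 : (κ : ℝ) * (η * y) ≤ g * y := by
    rw [← mul_assoc]
    gcongr
    rw [hη, mul_div_assoc', div_le_iff₀ (by positivity)]
    nlinarith
  linarith

section Lower

variable {ψ : Fin N → (Fin d → ℝ) → 𝕜} (T : DyadicCovering ψ)

/-- The covering property is applied to the fractional part of `2^j x`, the relative position of `x`
in its cube. -/
theorem DyadicCovering.exists_le_wavelet_cube : ∃ C : ℝ, 0 < C ∧ ∀ x : Fin d → ℝ, ∀ j, ∃ l,
    C ≤ ‖wavelet ψ (T.idx l) (T.cube l j (cubeAt j x)).1 (T.cube l j (cubeAt j x)).2 x‖ := by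
  obtain ⟨C, hC, h⟩ := T.exists_bound
  refine ⟨C, hC, fun x j => ?_⟩
  obtain ⟨l, hl⟩ := h (fun a => Int.fract ((2 : ℝ) ^ j * x a))
    fun a => ⟨Int.fract_nonneg _, Int.fract_lt_one _⟩
  refine ⟨l, hl.trans_eq ?_⟩
  simp only [wavelet, DyadicCovering.cube, cubeAt, Int.fract]
  congr 2
  funext a
  push_cast
  ring

/-- Near every point of the unit cube there are, in short intervals of scales, cubes such that the
coefficients of their dyadic covering almost saturate the lower bounds `e_ν`. -/
def IsLargeNear (s : ℝ) (p : ℝ≥0∞) (κ : ℕ) (c : Coeffs 𝕜 d N) : Prop :=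
  ∀ᶠ n : ℕ in atTop, ∀ x ∈ unitCube d, ∃ m, n ≤ m ∧ m < n + (Nat.sqrt n + 1) ∧ ∀ l,
    (T.L : ℝ)⁻¹ * (1 / 2) ^ (κ * (Nat.sqrt n + 1)) *
      eCoeff s p (m * T.depth) (cubeAt (m * T.depth) x) ≤
    ‖c (T.idx l) (T.cube l (m * T.depth) (cubeAt (m * T.depth) x)).1
      (T.cube l (m * T.depth) (cubeAt (m * T.depth) x)).2‖

variable {T} {s : ℝ} {p : ℝ≥0∞} {κ : ℕ} {c : Coeffs 𝕜 d N}

/-- The divergence exponent is large at the points that are frequently close to a corner of a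
dyadic cube of a larger scale. -/
theorem IsLargeNear.le_divExponent (hc : IsLargeNear T s p κ c) {x : Fin d → ℝ}
    (hx : x ∈ unitCube d) {θ : ℝ}
    (hθ : ∃ᶠ n : ℕ in atTop, ∀ m, n ≤ m → m < n + (Nat.sqrt n + 1) →
      (irredScale (m * T.depth) (cubeAt (m * T.depth) x) : ℝ) ≤ θ * ((m * T.depth : ℕ) : ℝ)) :
    ((dimOver d p - s - dimOver d p * θ : ℝ) : EReal) ≤ divExponent ψ c x := by
  refine le_divExponent_of_forall_lt fun γ' hγ' => frequently_atTop.2 fun J₀ => ?_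
  set γ := dimOver d p - s - dimOver d p * θ with hγ
  obtain ⟨C, hC, hwav⟩ := T.exists_le_wavelet_cube
  have hL : (0 : ℝ) < T.L := by exact_mod_cast Fin.pos_iff_nonempty.2 T.nonempty_fin
  -- The constant compensates `L⁻¹`, the lower bound `C` of the wavelet, and the passage from scale
  -- `y` to `y + j_l ≤ y + M`.
  obtain ⟨Y, hY⟩ := eventually_atTop.1
    (eventually_mul_two_rpow_le_sub hγ' (T.L * C⁻¹ * 2 ^ (|γ'| * T.depth)) κ)
  obtain ⟨n, hn, hcn, hnJ⟩ := (hθ.and_eventually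
    (hc.and (eventually_ge_atTop (max J₀ Y)))).exists
  obtain ⟨m, hm1, hm2, hm⟩ := hcn x hx
  obtain ⟨l, hl⟩ := hwav x (m * T.depth)
  have hirr := hn m hm1 hm2
  have hcoef := hm l
  set y := m * T.depth with hy
  have hmy : m ≤ y := Nat.le_mul_of_pos_right m T.depth_pos
  have hny : n ≤ y := hm1.trans hmy
  have hyY := hY y ((le_max_right _ _).trans (hnJ.trans hny))
  refine ⟨y + T.scale l, ?_, T.idx l, (T.cube l y (cubeAt y x)).2, ?_⟩
  · exact ((le_max_left _ _).trans (hnJ.trans hny)).trans (Nat.le_add_right _ _)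
  rw [norm_mul]
  refine le_trans ?_ (mul_le_mul hcoef hl hC.le (norm_nonneg _))
  have he : (2 : ℝ) ^ (γ * (y : ℝ) - Real.log y ^ 2) ≤ eCoeff s p y (cubeAt y x) := by
    rw [eCoeff, ← Real.rpow_add two_pos, ← Real.rpow_add two_pos]
    apply Real.rpow_le_rpow_of_exponent_le one_le_two
    have := mul_le_mul_of_nonneg_left hirr (dimOver_nonneg d p)
    rw [hγ]
    linarith
  have hκ : (2 : ℝ) ^ (-(κ * ((Nat.sqrt y : ℝ) + 1))) ≤ (1 / 2) ^ (κ * (Nat.sqrt n + 1)) := by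
    rw [one_div, inv_pow, ← Real.rpow_natCast, ← Real.rpow_neg zero_le_two]
    apply Real.rpow_le_rpow_of_exponent_le one_le_two
    push_cast
    have : (Nat.sqrt n : ℝ) ≤ Nat.sqrt y := by exact_mod_cast Nat.sqrt_le_sqrt hny
    gcongr
  have hj : (2 : ℝ) ^ (γ' * ((y + T.scale l : ℕ) : ℝ)) ≤
      2 ^ (|γ'| * T.depth) * 2 ^ (γ' * (y : ℝ)) := by
    rw [← Real.rpow_add two_pos]
    apply Real.rpow_le_rpow_of_exponent_le one_le_two
    push_cast
    have h1 : (T.scale l : ℝ) ≤ T.depth := by exact_mod_cast T.scale_le_depth l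
    have h2 : γ' * T.scale l ≤ |γ'| * T.depth := by
      gcongr
      exact le_abs_self _
    linarith
  calc (2 : ℝ) ^ (γ' * ((y + T.scale l : ℕ) : ℝ)) ≤ 2 ^ (|γ'| * T.depth) * 2 ^ (γ' * (y : ℝ)) := hj
    _ = (T.L : ℝ)⁻¹ * C * (T.L * C⁻¹ * 2 ^ (|γ'| * T.depth) * 2 ^ (γ' * (y : ℝ))) := by
        field_simp
    _ ≤ (T.L : ℝ)⁻¹ * C * 2 ^ (γ * (y : ℝ) - κ * (Nat.sqrt y + 1) - Real.log y ^ 2) := by gcongr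
    _ = (T.L : ℝ)⁻¹ * C * (2 ^ (-(κ * ((Nat.sqrt y : ℝ) + 1))) *
          2 ^ (γ * (y : ℝ) - Real.log y ^ 2)) := by
        rw [← Real.rpow_add two_pos]; ring_nf
    _ ≤ (T.L : ℝ)⁻¹ * C * ((1 / 2) ^ (κ * (Nat.sqrt n + 1)) * eCoeff s p y (cubeAt y x)) := by
        gcongr
    _ = _ := by ring

theorem IsLargeNear.neg_le_divExponent (hc : IsLargeNear T s p κ c) {x : Fin d → ℝ}
    (hx : x ∈ unitCube d) : ((-s : ℝ) : EReal) ≤ divExponent ψ c x := by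
  have h := hc.le_divExponent hx (θ := 1) (Frequently.of_forall fun n m _ _ => by
    rw [one_mul]; exact_mod_cast irredScale_le _ _)
  rwa [mul_one, sub_right_comm, sub_self, zero_sub] at h

/-- A point above a corner of scale `J`, by less than `2^{-y}` in each coordinate, lies in the cube
of scale `y` having this very corner as its lower corner. -/
theorem irredScale_cubeAt_le {x : Fin d → ℝ} {J y : ℕ} {K : Fin d → ℤ} (hJ : J ≤ y)
    (hK : ∀ a, K a * (1 / 2 : ℝ) ^ J ≤ x a ∧ x a < K a * (1 / 2 : ℝ) ^ J + (1 / 2) ^ y) :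
    irredScale y (cubeAt y x) ≤ J := by
  have hcube : ∀ a, cubeAt y x a = K a * 2 ^ (y - J) := by
    intro a
    have h1 : (2 : ℝ) ^ y * (1 / 2) ^ J = 2 ^ (y - J) := by
      rw [← Nat.sub_add_cancel hJ, pow_add, mul_assoc, ← mul_pow, Nat.add_sub_cancel]; norm_num
    have h2 : (2 : ℝ) ^ y * (1 / 2) ^ y = 1 := by rw [← mul_pow]; norm_num
    rw [cubeAt, Int.floor_eq_iff]
    push_cast
    constructor
    · calc (K a : ℝ) * 2 ^ (y - J) = 2 ^ y * (K a * (1 / 2 : ℝ) ^ J) := by rw [← h1]; ring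
        _ ≤ _ := by gcongr; exact (hK a).1
    · calc (2 : ℝ) ^ y * x a < 2 ^ y * (K a * (1 / 2 : ℝ) ^ J + (1 / 2) ^ y) := by
            gcongr; exact (hK a).2
        _ = _ := by rw [mul_add, h2, ← h1]; ring
  refine irredScale_le_of_eq (k' := K) fun a => ?_
  rw [hcube a, mul_assoc, ← pow_add, Nat.sub_add_cancel hJ]

/-- A block `m` of scales from which on `J ≤ θ (m M)`. -/
def startBlock (θ : ℝ) (M J : ℕ) : ℕ := ⌈(J : ℝ) / (θ * M)⌉₊

/-- The end of the short interval of scales that starts at `startBlock θ M J`. -/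
def endScale (θ : ℝ) (M J : ℕ) : ℕ :=
  (startBlock θ M J + (Nat.sqrt (startBlock θ M J) + 1)) * M

/-! ### Windows of scales on which `J ≤ θ j`. -/

section Blocks

variable {θ : ℝ} {M : ℕ}

theorem le_mul_startBlock (hθ : 0 < θ) (hM : 0 < M) (J : ℕ) :
    (J : ℝ) ≤ θ * (startBlock θ M J * M : ℕ) := by
  have h := Nat.le_ceil ((J : ℝ) / (θ * M))
  rw [div_le_iff₀ (by positivity)] at h
  rw [startBlock]
  push_cast
  linarith

theorem le_startBlock_mul (hθ : 0 < θ) (hθ' : θ ≤ 1) (hM : 0 < M) (J : ℕ) :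
    J ≤ startBlock θ M J * M := by
  have h := le_mul_startBlock hθ hM J
  have h2 : θ * ((startBlock θ M J * M : ℕ) : ℝ) ≤ (startBlock θ M J * M : ℕ) :=
    mul_le_of_le_one_left (Nat.cast_nonneg _) hθ'
  exact_mod_cast h.trans h2

theorem le_endScale (hθ : 0 < θ) (hθ' : θ ≤ 1) (hM : 0 < M) (J : ℕ) : J ≤ endScale θ M J :=
  (le_startBlock_mul hθ hθ' hM J).trans (Nat.mul_le_mul_right _ (Nat.le_add_right _ _))

theorem endScale_le (hθ : 0 < θ) (hM : 0 < M) {A : ℝ} (hA : 1 / θ < A) :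
    ∃ C : ℝ, ∀ J : ℕ, (endScale θ M J : ℝ) ≤ A * J + C := by
  -- The window has about the square root of its starting block as length, so enlarging by `1 + η`
  -- covers it and gives the slope `(1 + η)/θ = A`.
  set η := θ * A - 1 with hη
  have hη0 : 0 < η := by
    rw [div_lt_iff₀ hθ] at hA
    rw [hη]; linarith
  refine ⟨(1 + η) * M + (1 / η + 1) * M, fun J => ?_⟩
  have h1 : (startBlock θ M J : ℝ) ≤ J / (θ * M) + 1 := (Nat.ceil_lt_add_one (by positivity)).le
  have h2 := nat_sqrt_le_mul_add hη0 (startBlock θ M J)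
  rw [endScale]
  push_cast
  calc _ ≤ ((1 + η) * (J / (θ * M) + 1) + (1 / η + 1)) * (M : ℝ) := by
        refine mul_le_mul_of_nonneg_right ?_ (Nat.cast_nonneg M)
        have := mul_le_mul_of_nonneg_left h1 (show 0 ≤ 1 + η by linarith)
        linarith
    _ = (1 + η) / θ * J + ((1 + η) * M + (1 / η + 1) * M) := by
        field_simp
        ring
    _ = _ := by rw [hη]; field_simp; ring

end Blocks

/-- The map that spreads the digits of the coordinates, into the dyadic cube `(J₀, K₀)`. -/
def spreadMap (φ : ℕ → ℕ) (J₀ : ℕ) (K₀ : Fin d → ℤ) (u : Fin d → ℝ) : Fin d → ℝ :=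
  fun a => (1 / 2) ^ J₀ * (K₀ a + spread φ (u a))

theorem exists_dist_le_spreadMap {φ : ℕ → ℕ} (hφ : StrictMono φ) {A C : ℝ} (hA : 0 < A)
    (hC : ∀ n : ℕ, (φ n : ℝ) ≤ A * n + C) (J₀ : ℕ) (K₀ : Fin d → ℤ) :
    ∃ D : ℝ, 0 ≤ D ∧ ∀ u ∈ unitCube d, ∀ v ∈ unitCube d,
      dist u v ≤ D * dist (spreadMap φ J₀ K₀ u) (spreadMap φ J₀ K₀ v) ^ (1 / A) := by
  obtain ⟨D, hD0, hD⟩ := exists_abs_sub_le_spread hφ hA hC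
  refine ⟨D * ((2 : ℝ) ^ J₀) ^ (1 / A), by positivity, fun u hu v hv => ?_⟩
  refine (dist_pi_le_iff (by positivity)).2 fun a => ?_
  rw [Real.dist_eq]
  refine (hD _ _ (hu a).1 (hu a).2 (hv a).1 (hv a).2).trans ?_
  rw [mul_assoc, ← Real.mul_rpow (by positivity) dist_nonneg]
  gcongr
  have h1 := dist_le_pi_dist (spreadMap φ J₀ K₀ u) (spreadMap φ J₀ K₀ v) a
  rw [Real.dist_eq] at h1
  have h2 : spreadMap φ J₀ K₀ u a - spreadMap φ J₀ K₀ v a =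
      (1 / 2) ^ J₀ * (spread φ (u a) - spread φ (v a)) := by simp only [spreadMap]; ring
  rw [h2, abs_mul, abs_of_pos (by positivity), one_div, inv_pow,
    inv_mul_le_iff₀ (by positivity)] at h1
  exact h1

/-- Truncating after `n` digits gives a grid point of scale `J₀ + φ n`. The remainder starts at `φ
(n+1)`, hence is tiny after a gap. -/
theorem spreadMap_corner {φ : ℕ → ℕ} (hφ : StrictMono φ) (J₀ : ℕ) (K₀ : Fin d → ℤ)
    (u : Fin d → ℝ) (n : ℕ) : ∃ K : Fin d → ℤ, ∀ a,
      K a * (1 / 2 : ℝ) ^ (J₀ + φ n) ≤ spreadMap φ J₀ K₀ u a ∧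
      spreadMap φ J₀ K₀ u a ≤ K a * (1 / 2 : ℝ) ^ (J₀ + φ n) + 2 * (1 / 2) ^ (J₀ + φ (n + 1)) := by
  choose K hK0 hK using fun a => exists_int_spreadSum hφ (u a) n
  have key : ∀ a, ((K₀ a * 2 ^ φ n + K a : ℤ) : ℝ) * (1 / 2 : ℝ) ^ (J₀ + φ n) =
      (1 / 2) ^ J₀ * (K₀ a + spreadSum φ (u a) n) := by
    intro a
    have : (2 : ℝ) ^ φ n * (1 / 2) ^ φ n = 1 := by rw [← mul_pow]; norm_num
    rw [hK, pow_add]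
    push_cast
    linear_combination (K₀ a * (1 / 2 : ℝ) ^ J₀) * this
  refine ⟨fun a => K₀ a * 2 ^ φ n + K a, fun a => ?_⟩
  rw [key]
  constructor
  · have := spreadSum_le_spread hφ (u a) n
    simp only [spreadMap]
    gcongr
  · have h := mul_le_mul_of_nonneg_left (spread_le_spreadSum_add hφ (u a) n)
      (show (0 : ℝ) ≤ (1 / 2) ^ J₀ by positivity)
    simp only [spreadMap]
    rw [pow_add]
    linarith

/-- The cube is chosen before `φ`, because the gaps used later depend on `J₀`. -/
theorem exists_spreadMap_mem {B : Set (Fin d → ℝ)} (hB : IsOpen B) (hne : B.Nonempty) :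
    ∃ (J₀ : ℕ) (K₀ : Fin d → ℤ), ∀ φ : ℕ → ℕ, StrictMono φ → ∀ u, spreadMap φ J₀ K₀ u ∈ B := by
  obtain ⟨x, hx⟩ := hne
  obtain ⟨ε, hε, hball⟩ := Metric.isOpen_iff.1 hB x hx
  obtain ⟨J₀, hJ₀⟩ := exists_pow_lt_of_lt_one hε (show (1 / 2 : ℝ) < 1 by norm_num)
  refine ⟨J₀, cubeAt J₀ x, fun φ hφ u => hball ?_⟩
  rw [Metric.mem_ball]
  refine lt_of_le_of_lt ((dist_pi_le_iff (by positivity)).2 fun a => ?_) hJ₀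
  have h1 := Int.floor_le ((2 : ℝ) ^ J₀ * x a)
  have h2 := (Int.lt_floor_add_one ((2 : ℝ) ^ J₀ * x a)).le
  have h3 := spread_nonneg (φ := φ) (u a)
  have h4 := spread_le_one hφ (u a)
  have h5 : (1 / 2 : ℝ) ^ J₀ * 2 ^ J₀ = 1 := by rw [← mul_pow]; norm_num
  have h6 : spreadMap φ J₀ (cubeAt J₀ x) u a - x a =
      (1 / 2) ^ J₀ * (⌊(2 : ℝ) ^ J₀ * x a⌋ + spread φ (u a) - 2 ^ J₀ * x a) := by
    simp only [spreadMap, cubeAt]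
    linear_combination x a * h5
  rw [Real.dist_eq, h6, abs_mul, abs_of_pos (by positivity)]
  refine mul_le_of_le_one_right (by positivity) (abs_le.2 ⟨by linarith, by linarith⟩)

theorem IsLargeNear.le_divExponent_spreadMap (hc : IsLargeNear T s p κ c) {θ : ℝ} (hθ : 0 < θ)
    (hθ' : θ ≤ 1) (J₀ : ℕ) (K₀ : Fin d → ℤ) (u : Fin d → ℝ)
    (hu : spreadMap (gapSeq fun J => endScale θ T.depth (J₀ + J) + 1) J₀ K₀ u ∈ unitCube d) :
    ((dimOver d p - s - dimOver d p * θ : ℝ) : EReal) ≤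
      divExponent ψ c (spreadMap (gapSeq fun J => endScale θ T.depth (J₀ + J) + 1) J₀ K₀ u) := by
  have hM := T.depth_pos
  set w : ℕ → ℕ := fun J => endScale θ T.depth (J₀ + J) + 1 with hw
  have hwJ : ∀ J, J ≤ w J := fun J => by
    have := le_endScale hθ hθ' hM (J₀ + J)
    simp only [hw]; omega
  have hφ := gapSeq_strictMono hwJ
  refine hc.le_divExponent hu (frequently_atTop.2 fun n₀ => ?_)
  -- Starting from `n₀ M` forces the first block of the window to be at least `n₀`.
  obtain ⟨n, hn, hgap⟩ := exists_gap w (n₀ * T.depth)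
  set J := J₀ + gapSeq w n with hJ
  refine ⟨startBlock θ T.depth J, ?_, fun m hm1 hm2 => ?_⟩
  · have h1 : n ≤ gapSeq w n := hφ.le_apply
    have h2 := le_startBlock_mul hθ hθ' hM J
    exact le_of_mul_le_mul_right
      (show n₀ * T.depth ≤ startBlock θ T.depth J * T.depth by omega) hM
  · have h1 : startBlock θ T.depth J * T.depth ≤ m * T.depth := Nat.mul_le_mul_right _ hm1
    have h2 : m * T.depth ≤ endScale θ T.depth J := Nat.mul_le_mul_right _ hm2.le
    obtain ⟨K, hK⟩ := spreadMap_corner hφ J₀ K₀ u n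
    have h3 : irredScale (m * T.depth) (cubeAt (m * T.depth) (spreadMap (gapSeq w) J₀ K₀ u)) ≤ J := by
      refine irredScale_cubeAt_le ((le_startBlock_mul hθ hθ' hM J).trans h1)
        fun a => ⟨(hK a).1, (hK a).2.trans_lt ?_⟩
      -- The gap ends at least 2 beyond the last scale of the window: one unit offsets the factor 2
      -- of the tail, the other gives strictness.
      have h4 : (2 : ℝ) * (1 / 2) ^ (J₀ + gapSeq w (n + 1)) < (1 / 2) ^ (m * T.depth) := by
        calc (2 : ℝ) * (1 / 2) ^ (J₀ + gapSeq w (n + 1)) ≤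
            2 * (1 / 2) ^ (m * T.depth + 2) := by
              refine mul_le_mul_of_nonneg_left
                (pow_le_pow_of_le_one (by norm_num) (by norm_num) ?_) zero_le_two
              have hwJ' : w (gapSeq w n) = endScale θ T.depth J + 1 := rfl
              rw [hgap, hwJ']
              omega
          _ < _ := by
              have : (0 : ℝ) < (1 / 2) ^ (m * T.depth) := by positivity
              rw [pow_add]; linarith
      linarith
    calc _ ≤ (J : ℝ) := by exact_mod_cast h3
      _ ≤ θ * (startBlock θ T.depth J * T.depth : ℕ) := le_mul_startBlock hθ hM J
      _ ≤ _ := by gcongr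

/-- A lower bound for the dimension of a level set of the divergence exponent. -/
theorem IsLargeNear.le_dimH_level (hc : IsLargeNear T s p κ c) {θ : ℝ} (hθ : 0 < θ)
    (hθ' : θ ≤ 1) (hd : 0 < d)
    (hup : ∀ η > 0, dimH {x | ((dimOver d p - s - dimOver d p * θ + η : ℝ) : EReal) ≤
      divExponent ψ c x} < ENNReal.ofReal (θ * d))
    {B : Set (Fin d → ℝ)} (hB : IsOpen B) (hne : B.Nonempty) (hsub : B ⊆ unitCube d) :
    ENNReal.ofReal (θ * d) ≤ dimH {x | x ∈ B ∧ divExponent ψ c x =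
      ((dimOver d p - s - dimOver d p * θ : ℝ) : EReal)} := by
  have hM := T.depth_pos
  have hd' : (0 : ℝ) < d := by exact_mod_cast hd
  set γ := dimOver d p - s - dimOver d p * θ with hγ
  by_contra! hlt
  obtain ⟨J₀, K₀, hmem⟩ := exists_spreadMap_mem hB hne
  set w : ℕ → ℕ := fun J => endScale θ T.depth (J₀ + J) + 1 with hw
  have hwJ : ∀ J, J ≤ w J := fun J => by
    have := le_endScale hθ hθ' hM (J₀ + J)
    simp only [hw]; omega
  have hφ := gapSeq_strictMono hwJ
  have hgrow : ∀ A, 1 / θ < A → ∃ C, ∀ J : ℕ, (w J : ℝ) ≤ A * J + C := by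
    intro A hA
    obtain ⟨C, hC⟩ := endScale_le hθ hM hA
    refine ⟨A * J₀ + C + 1, fun J => ?_⟩
    have := hC (J₀ + J)
    simp only [hw]
    push_cast at this ⊢
    linarith
  set X := spreadMap (gapSeq w) J₀ K₀ with hX
  have hnull : ∀ S : Set (Fin d → ℝ), dimH S < ENNReal.ofReal (θ * d) →
      volume (unitCube d ∩ X ⁻¹' S) = 0 := by
    intro S hS
    obtain ⟨h, -, h1, h2⟩ := ENNReal.lt_iff_exists_real_btwn.1 hS
    have h3 : h < θ * d := (ENNReal.ofReal_lt_ofReal_iff (by positivity)).1 h2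
    -- An exponent with `dimH S < r d` and `0 < r < θ`; the term `θ / 2` only keeps it positive.
    set r := max (h / d) (θ / 2) with hr
    have hr0 : 0 < r := lt_of_lt_of_le (by positivity) (le_max_right _ _)
    have hrθ : r < θ := max_lt (by rwa [div_lt_iff₀ hd']) (by linarith)
    have hA : 1 / θ < 1 / r := one_div_lt_one_div_of_lt hr0 hrθ
    obtain ⟨C, -, hC⟩ := gapSeq_le hwJ (by rw [le_div_iff₀ hθ]; linarith) hgrow hA
    obtain ⟨D, hD0, hD⟩ := exists_dist_le_spreadMap hφ (by positivity) hC J₀ K₀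
    rw [one_div_one_div] at hD
    refine volume_inter_preimage_eq_zero hr0 hD0 hD (h1.trans_le (ENNReal.ofReal_le_ofReal ?_))
    rw [← div_le_iff₀ hd']
    exact le_max_left _ _
  -- Every image point lies in `B` and has exponent at least `γ`: it is in the level set, or its
  -- exponent exceeds `γ` by some `1/(n+1)`.
  have hcover : unitCube d ⊆ (unitCube d ∩ X ⁻¹' {x | x ∈ B ∧ divExponent ψ c x = (γ : EReal)}) ∪
      ⋃ n : ℕ, unitCube d ∩ X ⁻¹' {x | ((γ + 1 / ((n : ℝ) + 1) : ℝ) : EReal) ≤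
        divExponent ψ c x} := by
    intro u hu
    have hXB := hmem _ hφ u
    rcases (hc.le_divExponent_spreadMap hθ hθ' J₀ K₀ u (hsub hXB)).eq_or_lt with heq | hgt
    · exact Or.inl ⟨hu, hXB, heq.symm⟩
    · obtain ⟨γ', h1, h2⟩ := EReal.lt_iff_exists_real_btwn.1 hgt
      obtain ⟨n, hn⟩ := exists_nat_one_div_lt (sub_pos.2 (EReal.coe_lt_coe_iff.1 h1))
      refine Or.inr (mem_iUnion.2 ⟨n, hu, le_trans ?_ h2.le⟩)
      exact EReal.coe_le_coe_iff.2 (by linarith)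
  have hzero : volume (unitCube d) = 0 := by
    refine measure_mono_null hcover (measure_union_null (hnull _ hlt) (measure_iUnion_null fun n => ?_))
    exact hnull _ (hup _ (by positivity))
  exact (hB.measure_pos volume hne).ne' (measure_mono_null hsub hzero)

/-- For finite `p` the covering bound at this level is `θ d - p η` (or 0 if this is negative). For
`p = ∞` the set is empty, since no exponent exceeds `-s`. -/
theorem dimH_gt_level_lt {q : ℝ≥0∞} (hψ : IsWaveletSystem ψ) (hp : 0 < p) (hc : InBesov s p q c)
    (hd : 0 < d) {θ : ℝ} (hθ : 0 < θ) {η : ℝ} (hη : 0 < η) :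
    dimH {x | ((dimOver d p - s - dimOver d p * θ + η : ℝ) : EReal) ≤ divExponent ψ c x} <
      ENNReal.ofReal (θ * d) := by
  have hpos : 0 < θ * d := by positivity
  rcases eq_or_ne p ∞ with rfl | hp'
  · have : {x | ((dimOver d ∞ - s - dimOver d ∞ * θ + η : ℝ) : EReal) ≤ divExponent ψ c x} = ∅ := by
      refine eq_empty_of_forall_notMem fun x hx => ?_
      have h := EReal.coe_le_coe_iff.1 (hx.trans (divExponent_le hψ hp hc x))
      rw [dimOver_top] at h
      linarith
    rw [this, dimH_empty]
    exact ENNReal.ofReal_pos.2 hpos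
  · refine (dimH_le_divExponent_le hψ hp hp' hc _).trans_lt
      ((ENNReal.ofReal_lt_ofReal_iff hpos).2 ?_)
    have hP : 0 < p.toReal := ENNReal.toReal_pos hp.ne' hp'
    have h1 := toReal_mul_dimOver hp hp' (d := d)
    have h2 : 0 < p.toReal * η := by positivity
    have h3 : p.toReal * (s + (dimOver d p - s - dimOver d p * θ + η)) =
      d - θ * d + p.toReal * η := by linear_combination (1 - θ) * h1
    linarith

/-! ### Conclusion: combination of the upper and lower bounds. -/

theorem IsLargeNear.isMaximallyDivergent {q : ℝ≥0∞} (hψ : IsWaveletSystem ψ) (hp : 0 < p)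
    (hd : 0 < d) (hc : InBesov s p q c) (hlarge : IsLargeNear T s p κ c) :
    IsMaximallyDivergent ψ s p q (unitCube d) c := by
  have hd' : (0 : ℝ) < d := by exact_mod_cast hd
  refine ⟨hc, fun x hx => ⟨hlarge.neg_le_divExponent hx, divExponent_le hψ hp hc x⟩, ?_, ?_⟩
  · have hnull : ∀ n : ℕ, volume {x | ((-s + 1 / ((n : ℝ) + 1) : ℝ) : EReal) ≤
        divExponent ψ c x} = 0 := by
      intro n
      refine volume_eq_zero_of_dimH_lt ?_
      have h := dimH_gt_level_lt hψ hp hc hd one_pos (η := 1 / ((n : ℝ) + 1)) (by positivity)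
      rwa [mul_one, sub_right_comm, sub_self, zero_sub, one_mul, ENNReal.ofReal_natCast] at h
    have hae : ∀ᵐ x ∂(volume : Measure (Fin d → ℝ)), ∀ n : ℕ,
        ¬ ((-s + 1 / ((n : ℝ) + 1) : ℝ) : EReal) ≤ divExponent ψ c x :=
      ae_all_iff.2 fun n => measure_eq_zero_iff_ae_notMem.1 (hnull n)
    filter_upwards [hae] with x hx hxA
    refine ((hlarge.neg_le_divExponent hxA).eq_or_lt.resolve_right fun hgt => ?_).symm
    obtain ⟨γ', h1, h2⟩ := EReal.lt_iff_exists_real_btwn.1 hgt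
    obtain ⟨n, hn⟩ := exists_nat_one_div_lt (sub_pos.2 (EReal.coe_lt_coe_iff.1 h1))
    exact hx n (le_trans (EReal.coe_le_coe_iff.2 (by linarith)) h2.le)
  · intro B hB hne hsub γ hγ
    have hlower : ∀ θ : ℝ, 0 < θ → θ ≤ 1 → γ = dimOver d p - s - dimOver d p * θ →
        ENNReal.ofReal (θ * d) ≤ dimH {x | x ∈ B ∧ divExponent ψ c x = (γ : EReal)} := by
      rintro θ h0 h1 rfl
      exact hlarge.le_dimH_level h0 h1 hd (fun η hη => dimH_gt_level_lt hψ hp hc hd h0 hη)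
        hB hne hsub
    rcases eq_or_ne p ∞ with rfl | hp'
    · have hγs : γ = -s := by
        have h1 := hγ.2
        rw [dimOver_top, zero_sub] at h1
        exact le_antisymm h1 hγ.1
      have h := hlower 1 one_pos le_rfl (by rw [hγs, dimOver_top]; ring)
      rw [one_mul, ENNReal.ofReal_natCast] at h
      rw [hγs, add_neg_cancel, ENNReal.ofReal_zero, mul_zero, tsub_zero, ← hγs]
      exact le_antisymm ((dimH_mono (subset_univ _)).trans_eq (Real.dimH_univ_pi_fin d)) h
    · have hP : 0 < p.toReal := ENNReal.toReal_pos hp.ne' hp'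
      have hdim := toReal_mul_dimOver hp hp' (d := d)
      have hsγ : 0 ≤ s + γ := by linarith [hγ.1]
      have htarget : (d : ℝ≥0∞) - p * ENNReal.ofReal (s + γ) =
          ENNReal.ofReal (d - p.toReal * (s + γ)) := by
        rw [ENNReal.ofReal_sub _ (by positivity), ENNReal.ofReal_natCast,
          ENNReal.ofReal_mul hP.le, ENNReal.ofReal_toReal hp']
      rw [htarget]
      refine le_antisymm ((dimH_mono fun x hx => hx.2.ge).trans
        (dimH_le_divExponent_le hψ hp hp' hc γ)) ?_
      -- At the endpoint `γ = d/p - s` the dimension is 0 and the lower bound is trivial. Otherwise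
      -- `θ` is the expected dimension divided by `d`.
      rcases le_or_gt (d - p.toReal * (s + γ)) 0 with h0 | h0
      · rw [ENNReal.ofReal_of_nonpos h0]; exact zero_le
      · have h := hlower ((d - p.toReal * (s + γ)) / d) (by positivity)
          ((div_le_one hd').2 (by
            have : 0 ≤ p.toReal * (s + γ) := by positivity
            linarith)) ?_
        · rwa [div_mul_cancel₀ _ hd'.ne'] at h
        · have hdo : dimOver d p = d / p.toReal := by rw [← hdim]; field_simp
          rw [hdo]
          field_simp
          ring

end Lower

end WaveletDivergence

end

theorem WaveletDivergence.ae_abs_le_one_of_isUniform {Ω : Type*} [MeasurableSpace Ω]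
    {P : Measure Ω} {X : Ω → ℝ} (hX : pdf.IsUniform X (Set.Icc (-1 : ℝ) 1) P) :
    ∀ᵐ ω ∂P, |X ω| ≤ 1 := by
  have h := hX.measure_preimage (by rw [Real.volume_Icc]; norm_num)
    (by rw [Real.volume_Icc]; norm_num) (measurableSet_Icc (a := (-1 : ℝ)) (b := 1)).compl
  rw [inter_compl_self, measure_empty, ENNReal.zero_div] at h
  filter_upwards [measure_eq_zero_iff_ae_notMem.1 h] with ω hω
  simpa [abs_le] using hω

theorem mainTheorem9 {𝕜 : Type*} [RCLike 𝕜] {d N : ℕ} (hd : 0 < d)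
    (ψ : Fin N → (Fin d → ℝ) → 𝕜) (hψ : WaveletDivergence.IsWaveletSystem ψ)
    (T : WaveletDivergence.DyadicCovering ψ)
    (s : ℝ) (p q : ℝ≥0∞) (hp : 0 < p) (hq : 0 < q)
    {Ω : Type*} [MeasurableSpace Ω] (P : Measure Ω) [IsProbabilityMeasure P]
    (ξ : Fin N × ℕ × (Fin d → ℤ) → Ω → ℝ)
    (hξ_meas : ∀ a, Measurable (ξ a))
    (hξ_unif : ∀ a, pdf.IsUniform (ξ a) (Set.Icc (-1 : ℝ) 1) P)
    (hξ_indep : iIndepFun ξ P)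
    (D : WaveletDivergence.Coeffs 𝕜 d N) (hD : WaveletDivergence.InBesov s p q D) :
    ∀ᵐ ω ∂P, WaveletDivergence.IsMaximallyDivergent ψ s p q (WaveletDivergence.unitCube d)
      (WaveletDivergence.saturating T s p (fun a => ξ a ω) + D) := by
  have hle : ∀ᵐ ω ∂P, ∀ a, |ξ a ω| ≤ 1 := ae_all_iff.2 fun a =>
    WaveletDivergence.ae_abs_le_one_of_isUniform (hξ_unif a)
  obtain ⟨κ, hκ⟩ := WaveletDivergence.ae_eventually_exists_large T s p hξ_unif hξ_indep D
  filter_upwards [hle, hκ] with ω h1 h2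
  exact WaveletDivergence.IsLargeNear.isMaximallyDivergent (T := T) (κ := κ) hψ hp hd
    ((WaveletDivergence.inBesov_saturating hp hq h1).add hp hD) h2
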